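/- Cutting and stacking. Let $r_n\ge 1$ and $s_{n,i}\ge 0$ ($n\ge 1$, $0\le i\le r_n$) be integers. Start with the column $C_1$ consisting of the single level $[0,1)$. Given the column $C_n$, a finite ordered list of disjoint intervals ("levels") $[a,a+w_n)$ of equal length $w_n$, with union an interval $[0,m_n)$, cut each level into $r_n+1$ subintervals of equal length; this gives subcolumns numbered $0,\dots,r_n$ from left to right. Put $s_{n,i}$ new levels ("spacers") of the same length on top of the $i$-th subcolumn, using the leftmost unused intervals in $[m_n,\infty)$, and stack the subcolumns with their spacers in order, each on top of the preceding one, to obtain $C_{n+1}$. Let $Y$ be the union of all levels of all columns. The associated rank-one transformation $T$ is the common extension of the maps that translate each level of a column, other than its top level, onto the next level of that column (points of $Y$ that lie in the top level of every column containing them are fixed). If $Y$ has finite Lebesgue measure, $Y$ carries normalized Lebesgue measure $\mu$. The transformation $T$ of $(Y,\mu)$ is weakly mixing if it preserves $\mu$ and $T\times T$ is ergodic for $\mu\times\mu$. Symbolic model. Define words over $\{0,1\}$ by $B_1=0$ and $B_{n+1}=B_n1^{s_{n,0}}B_n1^{s_{n,1}}\cdots B_n1^{s_{n,r_n}}$.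 The subshift $X(T)$ associated to $T$ is the set of all $x\in\{0,1\}^{\mathbb Z}$ such that every finite subword of $x$ is a subword of some $B_n$, and $p(q)$ is the number of words of length $q$ that occur in elements of $X(T)$. **Theorem.** Let $\epsilon>0$ and let $f:\mathbb N\to\mathbb R$ satisfy $f(q)\to\infty$. Then there are an integer $\gamma>1$, integers $L_n>1$ with $L_n\to\infty$, and parameters $(r_n)$, $(s_{n,i})$ as above such that $$B_{n+1}=\bigl((B_n1)^{\gamma}B_n\bigr)^{L_n}\qquad\text{for all } n\ge 1,$$ the space $Y$ has finite Lebesgue measure, the rank-one transformation $T$ is weakly mixing on the probability space $(Y,\mu)$, and the complexity of the associated subshift $X(T)$ satisfies $$\limsup_{q\to\infty}\frac{p(q)}{q}<\frac32+\epsilon\qquad\text{and}\qquad p(q)<q+f(q)\ \text{ for infinitely many } q.$$ -/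

import Mathlib

/-! ## Subshifts on the alphabet `{0, 1}` -/

/-- The word `x_k x_{k+1} ⋯ x_{k+ℓ-1}` of length `ℓ` read off a biinfinite sequence `x`. -/
def window (x : ℤ → Fin 2) (k : ℤ) (ℓ : ℕ) : List (Fin 2) :=
  List.ofFn fun i : Fin ℓ => x (k + (i : ℕ))

/-- The language of a set of biinfinite sequences: all finite words occurring in its members. -/
def language (X : Set (ℤ → Fin 2)) : Set (List (Fin 2)) :=
  {w | ∃ x ∈ X, ∃ k : ℤ, window x k w.length = w}

/-- The word complexity `p_X(q)`: the number of words of length `q` in the language of `X`. -/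
noncomputable def complexity (X : Set (ℤ → Fin 2)) (q : ℕ) : ℕ :=
  {w | w ∈ language X ∧ w.length = q}.ncard

/-- The `k`-fold concatenation `w w ⋯ w`. -/
def wordPow (w : List (Fin 2)) (k : ℕ) : List (Fin 2) :=
  (List.replicate k w).flatten

/-! ## Weak mixing -/

/-- A measure-preserving transformation `T` of a probability space is weakly mixing when
`T × T` is ergodic. -/
def WeaklyMixing {Ω : Type*} [MeasurableSpace Ω] (T : Ω → Ω)
    (μ : MeasureTheory.Measure Ω) : Prop :=
  MeasureTheory.IsProbabilityMeasure μ ∧ MeasureTheory.MeasurePreserving T μ μ ∧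
    Ergodic (Prod.map T T) (μ.prod μ)

/-! ## Rank-one transformations by cutting and stacking -/

/-- The parameters of a cutting and stacking construction, the stages being numbered from `0`.
At stage `n` the column is cut `r n ≥ 1` times, into `r n + 1` subcolumns, and `s n i` spacers
are put on top of the `i`-th subcolumn, `0 ≤ i ≤ r n` (`s n i` is not used for `i > r n`). -/
structure RankOneData where
  /-- the cut sequence -/
  r : ℕ → ℕ
  /-- the spacer sequence -/
  s : ℕ → ℕ → ℕ
  one_le_r : ∀ n, 1 ≤ r n

namespace RankOneData

/-- The common width of the levels of the `n`-th column. -/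
noncomputable def width (D : RankOneData) : ℕ → ℝ
  | 0 => 1
  | n + 1 => D.width n / ((D.r n : ℝ) + 1)

/-- The left endpoints of the levels of the `n`-th column, from the bottom level to the top one.
The initial column is the single level `[0, 1)`.  The next column consists, for `i = 0, …, r n`
in turn, of the `i`-th sublevels (counted from the left) of all levels of the `n`-th column,
followed by `s n i` spacers.  The `n`-th column fills `[0, h w)`, with `h` its height and `w` its
width, and new spacers are the leftmost free intervals to the right of it. -/
noncomputable def lefts (D : RankOneData) : ℕ → List ℝ
  | 0 => [0]
  | n + 1 => (List.range (D.r n + 1)).flatMap fun (i : ℕ) =>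
      (D.lefts n).map (fun (a : ℝ) => a + (i : ℝ) * D.width (n + 1)) ++
      (List.range (D.s n i)).map (fun (k : ℕ) =>
        ((D.lefts n).length : ℝ) * D.width n +
          (((∑ l ∈ Finset.range i, D.s n l) + k : ℕ) : ℝ) * D.width (n + 1))

/-- The height of the `n`-th column. -/
noncomputable def height (D : RankOneData) (n : ℕ) : ℕ := (D.lefts n).length

/-- The left endpoint of the `j`-th level of the `n`-th column, for `j < D.height n`. -/
noncomputable def left (D : RankOneData) (n j : ℕ) : ℝ := (D.lefts n).getD j 0

/-- The `j`-th level of the `n`-th column, for `j < D.height n`. -/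
noncomputable def level (D : RankOneData) (n j : ℕ) : Set ℝ :=
  Set.Ico (D.left n j) (D.left n j + D.width n)

/-- The space on which the transformation lives: the union of all columns. -/
noncomputable def space (D : RankOneData) : Set ℝ :=
  ⋃ (n : ℕ) (j : ℕ) (_ : j < D.height n), D.level n j

/-- Some column sends `y` to `z`: the point `y` lies in a level of it other than the top one, and
`z` is the image of `y` under the translation of that level onto the next one. -/
def Step (D : RankOneData) (y z : ℝ) : Prop :=
  ∃ n j : ℕ, j + 1 < D.height n ∧ y ∈ D.level n j ∧ z = y + (D.left n (j + 1) - D.left n j)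

open Classical in
/-- The rank-one transformation: the common extension of the partial maps given by the columns.
The points outside the space, and the points of the null set of those that lie in the top level
of every column containing them, are fixed. -/
noncomputable def transformation (D : RankOneData) (y : ℝ) : ℝ :=
  if h : ∃ z, D.Step y z then h.choose else y

/-- Normalized Lebesgue measure on the space.  It is a probability measure when the space has
finite Lebesgue measure (and the zero measure otherwise). -/
noncomputable def measure (D : RankOneData) : MeasureTheory.Measure ℝ :=
  (MeasureTheory.volume D.space)⁻¹ • MeasureTheory.volume.restrict D.space

/-! ## The symbolic model -/

/-- The words `B_n` coding the columns: the initial word is `0`, and the word `B_{n+1}` is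
`B_n 1^{s n 0} B_n 1^{s n 1} ⋯ B_n 1^{s n (r n)}`. -/
def word (D : RankOneData) : ℕ → List (Fin 2)
  | 0 => [0]
  | n + 1 => (List.range (D.r n + 1)).flatMap fun (i : ℕ) =>
      D.word n ++ List.replicate (D.s n i) 1

/-- The subshift associated to the rank-one transformation: all biinfinite sequences every finite
subword of which is a subword of some `B_n`. -/
def subshift (D : RankOneData) : Set (ℤ → Fin 2) :=
  {x | ∀ (k : ℤ) (ℓ : ℕ), ∃ n, window x k ℓ <:+: D.word n}

end RankOneData

/-! ## Counting factors of concatenations of two blocks -/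

/-! Write `u_n = (B_n 1)^γ B_n`, so that `B_{n+1} = u_n^{L_n}`. Complexity. Every factor of the
words `B_m` is a factor of a concatenation of copies of two blocks, which may be taken to be
`1B_{n+1}, 1B_{n+1}B_{n+1}` or `u_n, u_n1u_n`. In both cases the shorter block is a prefix of the
longer one, the two share a long suffix `S`, and the longer one without its first letter has a small
period `π`. A factor of length `q ≤ 2|S|` either lies inside that periodic word, which allows at
most `π` words, or meets the start of a block; then the part to the right is determined by its
length, and the part to the left takes one value up to length `|S|` and at most two beyond. This
gives the bound `π + q + max(q - |S|, 0)` of `ncard_blockFactors_le`. The first pair has `π =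
|u_n|`, `S = B_{n+1}`, the second has `π = |B_n| + 1`, `S = u_n`; together they cover `2|B_n| ≤ q ≤
2|B_{n+1}|` and give `3q/2` up to an error that is small relative to `q` when `γ` and all `L_n` are
large (`ncard_factorsOfLength_le`). At `q = |B_{n+1}|` the bound is `q + |u_n|`, and `L_n` is chosen
after `u_n`, large enough for `f q > |u_n|`. Weak mixing. In each column definite proportions of the
subcolumns carry no spacer and one spacer. At time `|B_n| + 1`, the former send each level (but the
top one) to the next level, the latter send it to itself. A `T × T`-invariant set is nearly a union
of products of levels; on a fixed proportion of each product, the same power of `T × T` moves the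
first coordinate up by one level and keeps the second. The set is therefore also invariant under `T
× id`, hence has the same density in all products of levels, and so has measure 0 or 1
(`IsColumnSystem.ergodic_prodMap`). -/

theorem wordPow_zero (w : List (Fin 2)) : wordPow w 0 = [] := by simp [wordPow]

theorem wordPow_succ (w : List (Fin 2)) (k : ℕ) : wordPow w (k + 1) = w ++ wordPow w k := by
  simp [wordPow, List.replicate_succ]

theorem wordPow_add (w : List (Fin 2)) (k l : ℕ) :
    wordPow w (k + l) = wordPow w k ++ wordPow w l := by
  simp only [wordPow, List.replicate_add, List.flatten_append]

theorem wordPow_succ' (w : List (Fin 2)) (k : ℕ) : wordPow w (k + 1) = wordPow w k ++ w := by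
  rw [wordPow_add, wordPow_succ w 0, wordPow_zero, List.append_nil]

theorem length_wordPow (w : List (Fin 2)) (k : ℕ) :
    (wordPow w k).length = k * w.length := by
  simp [wordPow]

theorem getD_wordPow (z : List (Fin 2)) (k i : ℕ) (hi : i < k * z.length) :
    (wordPow z k).getD i 0 = z.getD (i % z.length) 0 := by
  induction k generalizing i with
  | zero => simp at hi
  | succ k ih =>
    rw [wordPow_succ]
    by_cases h : i < z.length
    · rw [List.getD_append _ _ _ _ h, Nat.mod_eq_of_lt h]
    · push Not at h
      rw [List.getD_append_right _ _ _ _ h, ih, ← Nat.mod_eq_sub_mod h]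
      rw [Nat.succ_mul] at hi
      omega

/-- A periodic word has at most as many factors of a given length as its period. -/
theorem ncard_infix_wordPow_le (z : List (Fin 2)) (hz : z ≠ []) (k q : ℕ) :
    {w : List (Fin 2) | w <:+: wordPow z k ∧ w.length = q}.Finite ∧
    {w : List (Fin 2) | w <:+: wordPow z k ∧ w.length = q}.ncard ≤ z.length := by
  have hsub : {w : List (Fin 2) | w <:+: wordPow z k ∧ w.length = q} ⊆
      (fun a : ℕ => List.ofFn fun i : Fin q => z.getD ((a + i) % z.length) 0) ''
        ((Finset.range z.length : Finset ℕ) : Set ℕ) := by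
    rintro w ⟨⟨s, t, hst⟩, hq⟩
    refine ⟨s.length % z.length, ?_, ?_⟩
    · simpa using Nat.mod_lt _ (List.length_pos_of_ne_nil hz)
    · have hlen := congrArg List.length hst
      simp only [List.length_append, length_wordPow] at hlen
      apply List.ext_getElem
      · simp [hq]
      · intro i h1 h2
        simp only [List.getElem_ofFn, Nat.mod_add_mod]
        rw [← getD_wordPow z k _ (by omega), ← hst, List.append_assoc,
          List.getD_append_right _ _ _ _ (by omega), List.getD_append _ _ _ _ (by omega),
          Nat.add_sub_cancel_left, List.getD_eq_getElem _ _ h2]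
  refine ⟨(Set.toFinite _).subset hsub, ?_⟩
  refine (Set.ncard_le_ncard hsub (Set.toFinite _)).trans ?_
  refine (Set.ncard_image_le (Set.toFinite _)).trans ?_
  rw [Set.ncard_coe_finset, Finset.card_range]

theorem exists_block {α : Type*} (l : List (List α)) (m : ℕ) (hm : m < l.flatten.length) :
    ∃ l₁ b l₂, l = l₁ ++ b :: l₂ ∧ l₁.flatten.length ≤ m ∧ m < l₁.flatten.length + b.length := by
  induction l generalizing m with
  | nil => simp at hm
  | cons a l ih =>
    by_cases h : m < a.length
    · exact ⟨[], a, l, by simp, by simp, by simpa using h⟩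
    · simp only [List.flatten_cons, List.length_append] at hm
      obtain ⟨l₁, b, l₂, rfl, h1, h2⟩ := ih (m - a.length) (by omega)
      refine ⟨a :: l₁, b, l₂, by simp, ?_, ?_⟩ <;>
        simp only [List.flatten_cons, List.length_append] <;> omega

theorem drop_eq_of_suffix {α : Type*} {x y : List α} {p : ℕ} (h : x <:+ y) (hp : p ≤ x.length) :
    x.drop (x.length - p) = y.drop (y.length - p) := by
  obtain ⟨t, rfl⟩ := h
  rw [List.length_append, List.drop_append,
    List.drop_eq_nil_of_le (by omega : t.length ≤ t.length + x.length - p), List.nil_append]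
  congr 1
  omega

/-! ### Factors of concatenations of two blocks with a common prefix and suffix. -/

/-- Words which are factors of a concatenation of copies of two given words. -/
def blockFactors (V V' : List (Fin 2)) : Set (List (Fin 2)) :=
  {w | ∃ l : List (List (Fin 2)), (∀ b ∈ l, b = V ∨ b = V') ∧ w <:+: l.flatten}

/-- Look at the block `b` containing the last letter of `w`. If `b` begins strictly before `w`, then
`w` avoids the first letter of `b`. Otherwise `b` begins at distance `p` from the start of `w`: what
follows is a prefix of `V'` because `V` is one, and what precedes depends only on `p` and, when `p >
|S|`, on the type of the previous block. -/
theorem blockFactors_cases {V V' S w : List (Fin 2)} (hpre : V <+: V') (hS : S <:+ V)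
    (hS' : S <:+ V') (hK : 2 * S.length ≤ V'.length) (hw : w ∈ blockFactors V V')
    (hq : w.length ≤ 2 * S.length) (h0 : w ≠ []) :
    w <:+: V'.tail ∨ (∃ p < w.length, w = V'.drop (V'.length - p) ++ V'.take (w.length - p)) ∨
      (∃ p < w.length, S.length ≤ p ∧
        w = (S ++ V).drop ((S ++ V).length - p) ++ V'.take (w.length - p)) := by
  obtain ⟨l, hl, s, t, hst⟩ := hw
  have hw0 := List.length_pos_of_ne_nil h0
  have hlen := congrArg List.length hst
  simp only [List.length_append] at hlen
  obtain ⟨l₁, b, l₂, rfl, h1, h2⟩ := exists_block l (s.length + w.length - 1) (by omega)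
  have hb : b <+: V' := by
    rcases hl b (by simp) with rfl | rfl
    · exact hpre
    · exact List.prefix_rfl
  have hwd : w = ((l₁ ++ b :: l₂).flatten.drop s.length).take w.length := by
    rw [← hst]; simp
  rw [List.flatten_append, List.flatten_cons] at hwd
  by_cases hlt : l₁.flatten.length < s.length
  · left
    have : w = (b.drop (s.length - l₁.flatten.length)).take w.length := by
      conv_lhs => rw [hwd]
      rw [List.drop_append, List.drop_eq_nil_of_le (by omega), List.nil_append,
        List.drop_append_of_le_length (by omega), List.take_append_of_le_length]
      simp only [List.length_drop]; omega
    rw [this]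
    refine (List.take_prefix _ _).isInfix.trans ?_
    obtain ⟨d, hd⟩ := hb
    have h3 : b.drop (s.length - l₁.flatten.length) <:+: b.tail := by
      rw [show s.length - l₁.flatten.length = 1 + (s.length - l₁.flatten.length - 1) by omega,
        ← List.drop_drop, List.drop_one]
      exact (List.drop_suffix _ _).isInfix
    refine h3.trans ?_
    have hbne : b ≠ [] := by rintro rfl; rw [List.length_nil] at h2; omega
    rw [← hd, List.tail_append_of_ne_nil hbne]
    exact (List.prefix_append _ _).isInfix
  · right
    push Not at hlt
    set p := l₁.flatten.length - s.length with hp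
    have hpw : p < w.length := by omega
    have hdec : w = l₁.flatten.drop (l₁.flatten.length - p) ++ V'.take (w.length - p) := by
      conv_lhs => rw [hwd]
      rw [List.drop_append_of_le_length hlt, List.take_append, List.take_of_length_le
        (by simp only [List.length_drop]; omega), List.length_drop, ← hp,
        List.take_append_of_le_length (by omega)]
      congr 1
      · congr 1; omega
      · obtain ⟨d, rfl⟩ := hb
        rw [List.take_append_of_le_length (by omega)]
    rcases List.eq_nil_or_concat l₁ with rfl | ⟨l₀, b', rfl⟩
    · left
      refine ⟨p, hpw, ?_⟩
      have : p = 0 := by simp at hp; omega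
      rw [this] at hdec ⊢
      simpa using hdec
    · rw [List.concat_eq_append] at *
      have hb' : b' = V ∨ b' = V' := hl b' (by simp)
      have hSS : S <:+ b' := by rcases hb' with rfl | rfl <;> assumption
      have hfl : (l₀ ++ [b']).flatten = l₀.flatten ++ b' := by simp
      have hsuf : b' <:+ (l₀ ++ [b']).flatten := by rw [hfl]; exact List.suffix_append _ _
      -- Up to length `|S|` all blocks have the same suffixes.
      by_cases hpK : p ≤ S.length
      · left
        refine ⟨p, hpw, hdec.trans ?_⟩
        rw [← drop_eq_of_suffix (hSS.trans hsuf) hpK, ← drop_eq_of_suffix hS' hpK]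
      · push Not at hpK
        rcases hb' with rfl | rfl
        · right
          refine ⟨p, hpw, hpK.le, hdec.trans ?_⟩
          congr 1
          -- A suffix longer than `V` enters the block before it, which ends in `S` whatever its
          -- type; since `p < 2|S| ≤ |S| + |V|`, it goes no further than that `S`.
          rcases List.eq_nil_or_concat l₀ with rfl | ⟨l₃, b'', rfl⟩
          · have hpb : p ≤ b'.length := by simp at hp; omega
            rw [← drop_eq_of_suffix hsuf hpb, ← drop_eq_of_suffix (List.suffix_append S b') hpb]
          · rw [List.concat_eq_append] at *
            have hb'' : b'' = b' ∨ b'' = V' := hl b'' (by simp)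
            have hS2 : S <:+ b'' := by rcases hb'' with rfl | rfl <;> assumption
            obtain ⟨d, rfl⟩ := hS2
            refine (drop_eq_of_suffix ⟨l₃.flatten ++ d, by simp⟩ ?_).symm
            have := hS.length_le
            rw [List.length_append]; omega
        · left
          refine ⟨p, hpw, hdec.trans ?_⟩
          -- Here `p < |w| ≤ 2|S| ≤ |V'|`, so the suffix stays inside the last block.
          rw [← drop_eq_of_suffix hsuf (by omega)]

theorem ncard_blockFactors_le {V V' S z : List (Fin 2)} {k : ℕ} (hpre : V <+: V') (hS : S <:+ V)
    (hS' : S <:+ V') (hK : 2 * S.length ≤ V'.length) (hz : z ≠ [])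
    (hper : V'.tail <:+: wordPow z k) {q : ℕ} (hq0 : 0 < q) (hq : q ≤ 2 * S.length) :
    {w | w ∈ blockFactors V V' ∧ w.length = q}.Finite ∧
    {w | w ∈ blockFactors V V' ∧ w.length = q}.ncard ≤ z.length + q + (q - S.length) := by
  have hsub : {w | w ∈ blockFactors V V' ∧ w.length = q} ⊆
      ({w : List (Fin 2) | w <:+: wordPow z k ∧ w.length = q} ∪
        (fun p => V'.drop (V'.length - p) ++ V'.take (q - p)) ''
          ((Finset.range q : Finset ℕ) : Set ℕ)) ∪
        (fun p => (S ++ V).drop ((S ++ V).length - p) ++ V'.take (q - p)) ''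
          ((Finset.Ico S.length q : Finset ℕ) : Set ℕ) := by
    rintro w ⟨hw, rfl⟩
    rcases blockFactors_cases hpre hS hS' hK hw hq (List.ne_nil_of_length_pos hq0) with
      h | ⟨p, hp, h⟩ | ⟨p, hp, hp', h⟩
    · exact Or.inl (Or.inl ⟨h.trans hper, rfl⟩)
    · exact Or.inl (Or.inr ⟨p, by simpa using hp, h.symm⟩)
    · exact Or.inr ⟨p, by simpa using ⟨hp', hp⟩, h.symm⟩
  obtain ⟨hf, hc⟩ := ncard_infix_wordPow_le z hz k q
  have hfin := (hf.union (Set.toFinite ((fun p => V'.drop (V'.length - p) ++ V'.take (q - p)) ''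
          ((Finset.range q : Finset ℕ) : Set ℕ)))).union (Set.toFinite
          ((fun p => (S ++ V).drop ((S ++ V).length - p) ++ V'.take (q - p)) ''
          ((Finset.Ico S.length q : Finset ℕ) : Set ℕ)))
  refine ⟨hfin.subset hsub, (Set.ncard_le_ncard hsub hfin).trans ?_⟩
  refine (Set.ncard_union_le _ _).trans (Nat.add_le_add ((Set.ncard_union_le _ _).trans
    (Nat.add_le_add hc ?_)) ?_)
  · refine (Set.ncard_image_le (Set.toFinite _)).trans ?_
    rw [Set.ncard_coe_finset, Finset.card_range]
  · refine (Set.ncard_image_le (Set.toFinite _)).trans ?_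
    rw [Set.ncard_coe_finset, Nat.card_Ico]

/-- Concatenations of copies of two given words. -/
def blockProducts (V V' : List (Fin 2)) : Set (List (Fin 2)) :=
  {w | ∃ l : List (List (Fin 2)), (∀ b ∈ l, b = V ∨ b = V') ∧ w = l.flatten}

/-! ### Decomposing powers of the spaced words into two blocks. -/

section blockProducts

variable {V V' x y : List (Fin 2)}

theorem nil_mem_blockProducts : [] ∈ blockProducts V V' := ⟨[], by simp, by simp⟩

theorem left_mem_blockProducts : V ∈ blockProducts V V' := ⟨[V], by simp, by simp⟩

theorem right_mem_blockProducts : V' ∈ blockProducts V V' := ⟨[V'], by simp, by simp⟩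

theorem append_mem_blockProducts (hx : x ∈ blockProducts V V') (hy : y ∈ blockProducts V V') :
    x ++ y ∈ blockProducts V V' := by
  obtain ⟨l, hl, rfl⟩ := hx
  obtain ⟨l', hl', rfl⟩ := hy
  refine ⟨l ++ l', ?_, by simp⟩
  intro b hb
  rcases List.mem_append.1 hb with h | h
  exacts [hl b h, hl' b h]

theorem wordPow_mem_blockProducts (hx : x ∈ blockProducts V V') (k : ℕ) :
    wordPow x k ∈ blockProducts V V' := by
  induction k with
  | zero => rw [wordPow_zero]; exact nil_mem_blockProducts
  | succ k ih => rw [wordPow_succ]; exact append_mem_blockProducts hx ih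

theorem mem_blockFactors_of_infix (h : x <:+: y) (hy : y ∈ blockProducts V V') :
    x ∈ blockFactors V V' := by
  obtain ⟨l, hl, rfl⟩ := hy
  exact ⟨l, hl, h⟩

theorem wordPow_append_comm (b c : List (Fin 2)) (k : ℕ) :
    wordPow (b ++ c) k ++ b = b ++ wordPow (c ++ b) k := by
  induction k with
  | zero => simp [wordPow_zero]
  | succ k ih => rw [wordPow_succ, wordPow_succ, List.append_assoc, ih]; simp

/-- The word `(b1)^γ b`. -/
def spacedPow (γ : ℕ) (b : List (Fin 2)) : List (Fin 2) := wordPow (b ++ [1]) γ ++ b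

theorem length_spacedPow (γ : ℕ) (b : List (Fin 2)) :
    (spacedPow γ b).length = (γ + 1) * b.length + γ := by
  simp only [spacedPow, List.length_append, length_wordPow, List.length_singleton]
  ring

/-- With `u = (b1)^γ b = b(1b)^γ`, one has `1b·u = (1bb)(1b)^γ`: each copy of `u` creates one `bb`,
and its last `1b` starts the next step. -/
theorem spaced_append_wordPow_mem {γ : ℕ} (hγ : 1 ≤ γ) {b : List (Fin 2)}
    (h1 : [1] ++ b ∈ blockProducts V V') (h2 : [1] ++ b ++ b ∈ blockProducts V V') (j : ℕ) :
    [1] ++ b ++ wordPow (spacedPow γ b) j ∈ blockProducts V V' := by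
  induction j with
  | zero => rw [wordPow_zero, List.append_nil]; exact h1
  | succ j ih =>
    obtain ⟨g, rfl⟩ := Nat.exists_eq_add_of_le' hγ
    have : [1] ++ b ++ wordPow (spacedPow (g + 1) b) (j + 1) =
        ([1] ++ b ++ b) ++ (wordPow ([1] ++ b) g ++
          ([1] ++ b ++ wordPow (spacedPow (g + 1) b) j)) := by
      rw [wordPow_succ]
      conv_lhs => enter [2, 1]; rw [spacedPow, wordPow_append_comm, wordPow_succ']
      simp only [List.append_assoc]
    rw [this]
    exact append_mem_blockProducts h2
      (append_mem_blockProducts (wordPow_mem_blockProducts h1 g) ih)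

theorem spaced_wordPow_mem {γ : ℕ} (hγ : 1 ≤ γ) {b : List (Fin 2)}
    (h1 : [1] ++ b ∈ blockProducts V V') (h2 : [1] ++ b ++ b ∈ blockProducts V V') {j : ℕ}
    (hj : 1 ≤ j) : [1] ++ wordPow (spacedPow γ b) j ∈ blockProducts V V' := by
  obtain ⟨i, rfl⟩ := Nat.exists_eq_add_of_le' hj
  have : [1] ++ wordPow (spacedPow γ b) (i + 1) =
      wordPow ([1] ++ b) γ ++ ([1] ++ b ++ wordPow (spacedPow γ b) i) := by
    have h3 : [1] ++ spacedPow γ b = wordPow ([1] ++ b) γ ++ ([1] ++ b) := by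
      rw [spacedPow, ← wordPow_succ', wordPow_succ, wordPow_append_comm]
      simp only [List.append_assoc]
    rw [wordPow_succ, ← List.append_assoc, h3]
    simp only [List.append_assoc]
  rw [this]
  exact append_mem_blockProducts (wordPow_mem_blockProducts h1 γ)
    (spaced_append_wordPow_mem hγ h1 h2 i)

/-- If `H = u^k`, then `u` followed by a concatenation of `1H` and `1HH` is a concatenation of
copies of `u` and `u1u`. -/
theorem append_mem_blockProducts_of_wordPow {u : List (Fin 2)} {k : ℕ} (hk : 2 ≤ k)
    (hx : x ∈ blockProducts ([1] ++ wordPow u k) ([1] ++ wordPow u k ++ wordPow u k)) :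
    ∃ y ∈ blockProducts u (u ++ [1] ++ u), u ++ x = y ++ u := by
  obtain ⟨l, hl, rfl⟩ := hx
  -- The identity `u·1u^j = (u1u)u^(j-2)·u`, valid for `j ≥ 2`, carries the extra `u` across a block
  -- to its right end.
  have key : ∀ b, b = [1] ++ wordPow u k ∨ b = [1] ++ wordPow u k ++ wordPow u k →
      ∃ y ∈ blockProducts u (u ++ [1] ++ u), u ++ b = y ++ u := by
    have : ∀ j, 2 ≤ j → ∃ y ∈ blockProducts u (u ++ [1] ++ u),
        u ++ ([1] ++ wordPow u j) = y ++ u := by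
      intro j hj
      obtain ⟨i, rfl⟩ := Nat.exists_eq_add_of_le' hj
      refine ⟨(u ++ [1] ++ u) ++ wordPow u i, append_mem_blockProducts right_mem_blockProducts
        (wordPow_mem_blockProducts left_mem_blockProducts i), ?_⟩
      rw [wordPow_succ, wordPow_succ']
      simp only [List.append_assoc]
    rintro b (rfl | rfl)
    · exact this k hk
    · rw [List.append_assoc [1], ← wordPow_add]
      exact this (k + k) (by omega)
  induction l with
  | nil => exact ⟨[], nil_mem_blockProducts, by simp⟩
  | cons b l ih =>
    obtain ⟨y, hy, hy'⟩ := key b (hl b (by simp))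
    obtain ⟨y', hy1, hy2⟩ := ih fun b hb => hl b (by simp [hb])
    refine ⟨y ++ y', append_mem_blockProducts hy hy1, ?_⟩
    rw [List.flatten_cons, ← List.append_assoc, hy', List.append_assoc, hy2, List.append_assoc]

end blockProducts

/-! ## Complexity of the symbolic model -/

/-- The factors of length `q` of the words of a sequence. -/
def factorsOfLength (B : ℕ → List (Fin 2)) (q : ℕ) : Set (List (Fin 2)) :=
  {w | (∃ m, w <:+: B m) ∧ w.length = q}

section Factors

variable {B : ℕ → List (Fin 2)} {γ : ℕ} {L : ℕ → ℕ}

theorem infix_of_le (hL : ∀ n, 1 < L n) (hB : ∀ n, B (n + 1) = wordPow (spacedPow γ (B n)) (L n))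
    {m n : ℕ} (h : m ≤ n) : B m <:+: B n := by
  induction n, h using Nat.le_induction with
  | base => exact List.infix_rfl
  | succ n _ ih =>
    refine ih.trans ?_
    obtain ⟨l, hl⟩ := Nat.exists_eq_add_of_lt (hL n)
    rw [hB n, hl, show 1 + l + 1 = (l + 1) + 1 by omega, wordPow_succ']
    exact ((List.suffix_append _ _).trans (List.suffix_append _ _)).isInfix

theorem spaced_mem_of_le (hγ : 1 < γ) (hL : ∀ n, 1 < L n)
    (hB : ∀ n, B (n + 1) = wordPow (spacedPow γ (B n)) (L n)) {k m : ℕ} (h : k ≤ m) :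
    [1] ++ B m ∈ blockProducts ([1] ++ B k) ([1] ++ B k ++ B k) ∧
    [1] ++ B m ++ B m ∈ blockProducts ([1] ++ B k) ([1] ++ B k ++ B k) := by
  induction m, h using Nat.le_induction with
  | base => exact ⟨left_mem_blockProducts, right_mem_blockProducts⟩
  | succ m _ ih =>
    have := hL m
    rw [hB m, List.append_assoc [1] (wordPow _ _), ← wordPow_add]
    exact ⟨spaced_wordPow_mem hγ.le ih.1 ih.2 this.le,
      spaced_wordPow_mem hγ.le ih.1 ih.2 (by omega)⟩

theorem infix_mem_blockFactors (hγ : 1 < γ) (hL : ∀ n, 1 < L n)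
    (hB : ∀ n, B (n + 1) = wordPow (spacedPow γ (B n)) (L n)) (k m : ℕ) {w : List (Fin 2)}
    (hw : w <:+: B m) : w ∈ blockFactors ([1] ++ B k) ([1] ++ B k ++ B k) :=
  mem_blockFactors_of_infix ((hw.trans (infix_of_le hL hB (le_max_right k m))).trans
    (List.suffix_append [1] _).isInfix) (spaced_mem_of_le hγ hL hB (le_max_left k m)).1

theorem infix_mem_blockFactors_spacedPow (hγ : 1 < γ) (hL : ∀ n, 1 < L n)
    (hB : ∀ n, B (n + 1) = wordPow (spacedPow γ (B n)) (L n)) (n m : ℕ) {w : List (Fin 2)}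
    (hw : w <:+: B m) :
    w ∈ blockFactors (spacedPow γ (B n)) (spacedPow γ (B n) ++ [1] ++ spacedPow γ (B n)) := by
  have h := (spaced_mem_of_le hγ hL hB (le_max_left (n + 1) m)).1
  rw [hB n] at h
  obtain ⟨y, hy, hy'⟩ := append_mem_blockProducts_of_wordPow (hL n) h
  refine mem_blockFactors_of_infix (y := y ++ spacedPow γ (B n)) ?_
    (append_mem_blockProducts hy left_mem_blockProducts)
  rw [← hy']
  exact ((hw.trans (infix_of_le hL hB (le_max_right (n + 1) m))).trans
    (List.suffix_append [1] _).isInfix).trans (List.suffix_append _ _).isInfix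

/-- Blocks `1B`, `1BB` with `B = B (n + 1)`: their common suffix is `B`, and `1BB` without its first
letter is `BB`, a power of `spacedPow γ (B n)`. -/
theorem ncard_factorsOfLength_le_of_le_word (hγ : 1 < γ) (hL : ∀ n, 1 < L n)
    (hB : ∀ n, B (n + 1) = wordPow (spacedPow γ (B n)) (L n)) (n : ℕ) {q : ℕ} (hq0 : 0 < q)
    (hq : q ≤ 2 * (B (n + 1)).length) :
    (factorsOfLength B q).Finite ∧ (factorsOfLength B q).ncard ≤
      (spacedPow γ (B n)).length + q + (q - (B (n + 1)).length) := by
  have hsub : factorsOfLength B q ⊆ {w | w ∈ blockFactors ([1] ++ B (n + 1))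
      ([1] ++ B (n + 1) ++ B (n + 1)) ∧ w.length = q} :=
    fun w ⟨⟨m, hm⟩, h⟩ => ⟨infix_mem_blockFactors hγ hL hB _ m hm, h⟩
  have hne : spacedPow γ (B n) ≠ [] := by
    apply List.ne_nil_of_length_pos
    rw [length_spacedPow]; omega
  obtain ⟨hf, hc⟩ := ncard_blockFactors_le (V := [1] ++ B (n + 1))
    (V' := [1] ++ B (n + 1) ++ B (n + 1)) (S := B (n + 1)) (z := spacedPow γ (B n))
    (k := L n + L n) (List.prefix_append _ _) (List.suffix_append _ _) (List.suffix_append _ _)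
    (by simp only [List.length_append]; omega) hne
    (by rw [wordPow_add, ← hB n]; simp) hq0 hq
  exact ⟨hf.subset hsub, (Set.ncard_le_ncard hsub hf).trans hc⟩

/-- Blocks `u`, `u1u`: their common suffix is `u`, and `u1u1 = (B_n 1)^(2γ+2)`, so the period is
only `|B_n| + 1`. -/
theorem ncard_factorsOfLength_le_of_le_spacedPow (hγ : 1 < γ) (hL : ∀ n, 1 < L n)
    (hB : ∀ n, B (n + 1) = wordPow (spacedPow γ (B n)) (L n)) (n : ℕ) {q : ℕ} (hq0 : 0 < q)
    (hq : q ≤ 2 * (spacedPow γ (B n)).length) :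
    (factorsOfLength B q).Finite ∧ (factorsOfLength B q).ncard ≤
      ((B n).length + 1) + q + (q - (spacedPow γ (B n)).length) := by
  set u := spacedPow γ (B n) with hu
  have hsub : factorsOfLength B q ⊆ {w | w ∈ blockFactors u (u ++ [1] ++ u) ∧ w.length = q} :=
    fun w ⟨⟨m, hm⟩, h⟩ => ⟨infix_mem_blockFactors_spacedPow hγ hL hB n m hm, h⟩
  have hper : (u ++ [1] ++ u).tail <:+: wordPow (B n ++ [1]) (γ + 1 + (γ + 1)) := by
    refine (List.tail_suffix _).isInfix.trans ?_
    have : wordPow (B n ++ [1]) (γ + 1 + (γ + 1)) = u ++ [1] ++ u ++ [1] := by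
      rw [wordPow_add, wordPow_succ', hu, spacedPow]
      simp only [List.append_assoc]
    rw [this]
    exact (List.prefix_append _ _).isInfix
  obtain ⟨hf, hc⟩ := ncard_blockFactors_le (V := u) (V' := u ++ [1] ++ u) (S := u)
    (z := B n ++ [1]) (by rw [List.append_assoc]; exact List.prefix_append _ _)
    List.suffix_rfl (List.suffix_append _ _)
    (by simp only [List.length_append]; omega) (by simp) hper hq0 hq
  refine ⟨hf.subset hsub, (Set.ncard_le_ncard hsub hf).trans ?_⟩
  simpa using hc

theorem length_succ (hB : ∀ n, B (n + 1) = wordPow (spacedPow γ (B n)) (L n)) (n : ℕ) :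
    (B (n + 1)).length = L n * (spacedPow γ (B n)).length := by
  rw [hB, length_wordPow]

theorem lt_length (h0 : 0 < (B 0).length) (hL : ∀ n, 1 < L n)
    (hB : ∀ n, B (n + 1) = wordPow (spacedPow γ (B n)) (L n)) (n : ℕ) : n < (B n).length := by
  induction n with
  | zero => exact h0
  | succ n ih =>
    rw [length_succ hB, length_spacedPow]
    have := hL n
    nlinarith [Nat.zero_le (γ * (B n).length), Nat.zero_le γ]

/-- With `c = |u_n|` and `H = |B_{n+1}|`, the bounds are `h + 1 + q` up to `c`, `h + 1 + 2q - c` up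
to `2c`, `c + q` up to `H` and `c + 2q - H` up to `2H`. In the first and third ranges `h` or `c` is
at most `q/2`; in the others `q - c` or `q - H` is, while `h ≤ δc` and `c ≤ δH` absorb the rest. -/
theorem ncard_factorsOfLength_le (h0 : (B 0).length = 1) (hγ : 1 < γ) (hL : ∀ n, 1 < L n)
    (hB : ∀ n, B (n + 1) = wordPow (spacedPow γ (B n)) (L n)) {δ : ℝ}
    (hδγ : 1 ≤ δ * γ) (hδL : ∀ n, 1 ≤ δ * L n) {q : ℕ} (hq : 2 ≤ q) :
    ((factorsOfLength B q).ncard : ℝ) ≤ (3 / 2 + δ) * q + 1 := by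
  have hδ : 0 ≤ δ := by
    by_contra! h
    have : (0 : ℝ) ≤ γ := by positivity
    nlinarith
  -- The stage at which `2|B_n|` is passed; `q ≥ 2 = 2|B_0|` makes it exist.
  obtain ⟨n, hn1, hn2⟩ : ∃ n, 2 * (B n).length ≤ q ∧ q < 2 * (B (n + 1)).length := by
    have hex : ∃ n, q < 2 * (B n).length := ⟨q, by have := lt_length (by omega) hL hB q; omega⟩
    classical
    rcases hN : Nat.find hex with _ | n
    · have := Nat.find_spec hex
      rw [hN] at this; omega
    · refine ⟨n, ?_, ?_⟩
      · have := Nat.find_min hex (m := n) (by omega)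
        omega
      · have := Nat.find_spec hex
        rwa [hN] at this
  have hc := length_spacedPow γ (B n)
  have hH := length_succ hB n
  set c := (spacedPow γ (B n)).length
  set H := (B (n + 1)).length
  set h := (B n).length
  have hcR : (c : ℝ) = (γ + 1) * h + γ := by exact_mod_cast hc
  have hHR : (H : ℝ) = L n * c := by exact_mod_cast hH
  have hγ0 : (0 : ℝ) ≤ γ := by positivity
  have hh0 : (0 : ℝ) ≤ h := by positivity
  have hc0 : (0 : ℝ) ≤ c := by positivity
  have hn1R : 2 * (h : ℝ) ≤ q := by exact_mod_cast hn1
  have hδh : (h : ℝ) ≤ δ * c := by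
    rw [hcR]
    nlinarith [mul_nonneg hδ hh0, mul_nonneg hδ hγ0, mul_le_mul_of_nonneg_right hδγ hh0]
  have hδc : (c : ℝ) ≤ δ * H := by
    rw [hHR]
    nlinarith [mul_le_mul_of_nonneg_right (hδL n) hc0]
  have hδq : 0 ≤ δ * q := by positivity
  by_cases hqc : q ≤ 2 * c
  · have := (ncard_factorsOfLength_le_of_le_spacedPow hγ hL hB n (by omega) hqc).2
    rcases le_total q c with h1 | h1
    · rw [Nat.sub_eq_zero_of_le h1] at this
      have hR : ((factorsOfLength B q).ncard : ℝ) ≤ h + 1 + q + 0 := by exact_mod_cast this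
      linarith
    · have hR : ((factorsOfLength B q).ncard : ℝ) ≤ h + 1 + q + (q - c) := by
        rw [← Nat.cast_sub h1]; exact_mod_cast this
      have h1R : (c : ℝ) ≤ q := by exact_mod_cast h1
      have h2R : (q : ℝ) ≤ 2 * c := by exact_mod_cast hqc
      nlinarith [mul_le_mul_of_nonneg_left h1R hδ]
  · have := (ncard_factorsOfLength_le_of_le_word hγ hL hB n (by omega) hn2.le).2
    push Not at hqc
    have h2R : 2 * (c : ℝ) ≤ q := by exact_mod_cast hqc.le
    rcases le_total q H with h1 | h1
    · rw [Nat.sub_eq_zero_of_le h1] at this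
      have hR : ((factorsOfLength B q).ncard : ℝ) ≤ c + q + 0 := by exact_mod_cast this
      linarith
    · have hR : ((factorsOfLength B q).ncard : ℝ) ≤ c + q + (q - H) := by
        rw [← Nat.cast_sub h1]; exact_mod_cast this
      have h1R : (H : ℝ) ≤ q := by exact_mod_cast h1
      have h2R : (q : ℝ) ≤ 2 * H := by exact_mod_cast hn2.le
      nlinarith [mul_le_mul_of_nonneg_left h1R hδ]

end Factors

theorem RankOneData.complexity_le (D : RankOneData) {q : ℕ}
    (hfin : (factorsOfLength D.word q).Finite) :
    complexity D.subshift q ≤ (factorsOfLength D.word q).ncard := by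
  refine Set.ncard_le_ncard ?_ hfin
  rintro w ⟨⟨x, hx, k, hk⟩, hq⟩
  obtain ⟨m, hm⟩ := hx k w.length
  exact ⟨⟨m, hk ▸ hm⟩, hq⟩

/-! ## A criterion for ergodicity of the square of a transformation -/

open MeasureTheory in
/-- Columns `I n 0, …, I n (h n - 1)` of levels of measure `v n` and diameter at most `w n`, which
exhaust the space and on which `T` acts by sending each level into the next one. -/
structure IsColumnSystem (T : ℝ → ℝ) (μ : Measure ℝ) (h : ℕ → ℕ) (I : ℕ → ℕ → Set ℝ)
    (v w : ℕ → ℝ) : Prop where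
  measurePreserving : MeasurePreserving T μ μ
  measurableSet : ∀ n j, MeasurableSet (I n j)
  eq_of_mem : ∀ n j k x, j < h n → k < h n → x ∈ I n j → x ∈ I n k → j = k
  dist_le : ∀ n j, ∀ x ∈ I n j, ∀ y ∈ I n j, dist x y ≤ w n
  measure_eq : ∀ n, ∀ j < h n, μ.real (I n j) = v n
  tendsto_width : Filter.Tendsto w Filter.atTop (nhds 0)
  tendsto_measure : Filter.Tendsto v Filter.atTop (nhds 0)
  tendsto_mul : Filter.Tendsto (fun n => h n * v n) Filter.atTop (nhds 1)
  step : ∀ n j x, j + 1 < h n → x ∈ I n j → T x ∈ I n (j + 1)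

/-- The union of the cells `I n j × I n k`, for `(j, k) ∈ J`. -/
def cellUnion (I : ℕ → ℕ → Set ℝ) (n : ℕ) (J : Finset (ℕ × ℕ)) : Set (ℝ × ℝ) :=
  ⋃ p ∈ J, I n p.1 ×ˢ I n p.2

namespace IsColumnSystem

open MeasureTheory Filter Topology symmDiff

variable {T : ℝ → ℝ} {μ : Measure ℝ} {h : ℕ → ℕ}
  {I : ℕ → ℕ → Set ℝ} {v w : ℕ → ℝ}

theorem mem_cellUnion_iff (S : IsColumnSystem T μ h I v w) {n : ℕ} {J : Finset (ℕ × ℕ)}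
    (hJ : J ⊆ Finset.range (h n) ×ˢ Finset.range (h n)) {z : ℝ × ℝ} {j j' : ℕ}
    (hj : j < h n) (hj' : j' < h n) (hz : z.1 ∈ I n j) (hz' : z.2 ∈ I n j') :
    z ∈ cellUnion I n J ↔ (j, j') ∈ J := by
  simp only [cellUnion, Set.mem_iUnion, Set.mem_prod, exists_prop]
  constructor
  · rintro ⟨⟨k, k'⟩, hk, h1, h2⟩
    have := hJ hk
    simp only [Finset.mem_product, Finset.mem_range] at this
    rw [S.eq_of_mem n j k z.1 hj this.1 hz h1, S.eq_of_mem n j' k' z.2 hj' this.2 hz' h2]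
    exact hk
  · intro hJ'
    exact ⟨(j, j'), hJ', hz, hz'⟩

theorem measurableSet_cellUnion (S : IsColumnSystem T μ h I v w) (n : ℕ) (J : Finset (ℕ × ℕ)) :
    MeasurableSet (cellUnion I n J) :=
  Finset.measurableSet_biUnion _ fun _ _ => (S.measurableSet _ _).prod (S.measurableSet _ _)

theorem pairwiseDisjoint_cell (S : IsColumnSystem T μ h I v w) {n : ℕ} {J : Finset (ℕ × ℕ)}
    (hJ : J ⊆ Finset.range (h n) ×ˢ Finset.range (h n)) :
    (J : Set (ℕ × ℕ)).PairwiseDisjoint fun p => I n p.1 ×ˢ I n p.2 := by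
  intro p hp p' hp' hne
  refine Set.disjoint_left.2 fun z hz hz' => hne ?_
  have h1 := hJ hp
  have h2 := hJ hp'
  simp only [Finset.mem_product, Finset.mem_range] at h1 h2
  exact Prod.ext (S.eq_of_mem n _ _ z.1 h1.1 h2.1 hz.1 hz'.1)
    (S.eq_of_mem n _ _ z.2 h1.2 h2.2 hz.2 hz'.2)

variable [IsProbabilityMeasure μ]

theorem measureReal_inter_cellUnion (S : IsColumnSystem T μ h I v w) {n : ℕ}
    {J : Finset (ℕ × ℕ)} (hJ : J ⊆ Finset.range (h n) ×ˢ Finset.range (h n))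
    {E : Set (ℝ × ℝ)} (hE : MeasurableSet E) :
    (μ.prod μ).real (E ∩ cellUnion I n J) =
      ∑ p ∈ J, (μ.prod μ).real (E ∩ I n p.1 ×ˢ I n p.2) := by
  rw [cellUnion, Set.inter_iUnion₂]
  refine measureReal_biUnion_finset ?_ ?_
  · exact (S.pairwiseDisjoint_cell hJ).mono fun p => Set.inter_subset_right
  · exact fun p _ => hE.inter ((S.measurableSet _ _).prod (S.measurableSet _ _))

theorem measureReal_cellUnion (S : IsColumnSystem T μ h I v w) {n : ℕ}
    {J : Finset (ℕ × ℕ)} (hJ : J ⊆ Finset.range (h n) ×ˢ Finset.range (h n)) :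
    (μ.prod μ).real (cellUnion I n J) = J.card * v n ^ 2 := by
  have := S.measureReal_inter_cellUnion hJ MeasurableSet.univ
  rw [Set.univ_inter] at this
  rw [this, Finset.sum_congr rfl (g := fun _ => v n ^ 2), Finset.sum_const, nsmul_eq_mul]
  intro p hp
  have h1 := hJ hp
  simp only [Finset.mem_product, Finset.mem_range] at h1
  rw [Set.univ_inter, measureReal_prod_prod, S.measure_eq n _ h1.1, S.measure_eq n _ h1.2, sq]

/-- Take a compact `K ⊆ E` and an open `O ⊇ K` of nearly equal measure, and the cells that meet `K`.
Once the cells have diameter below the distance from `K` to the complement of `O`, they lie in `O`;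
they cover `K` up to the small part outside the column. -/
theorem exists_cellUnion_approx (S : IsColumnSystem T μ h I v w) {E : Set (ℝ × ℝ)}
    (hE : MeasurableSet E) {δ : ℝ} (hδ : 0 < δ) :
    ∀ᶠ n in atTop, ∃ J ⊆ Finset.range (h n) ×ˢ Finset.range (h n),
      (μ.prod μ).real (E ∆ cellUnion I n J) ≤ δ := by
  have hδ' : ENNReal.ofReal (δ / 3) ≠ 0 := by
    rw [Ne, ENNReal.ofReal_eq_zero, not_le]; positivity
  obtain ⟨K, hKE, hK, hKm⟩ := hE.exists_isCompact_sdiff_lt (measure_ne_top (μ.prod μ) E) hδ'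
  obtain ⟨O, hKO, hO, -, hOm⟩ :=
    hK.measurableSet.exists_isOpen_sdiff_lt (measure_ne_top (μ.prod μ) K) hδ'
  obtain ⟨η, hη, hηO⟩ := hK.exists_thickening_subset_open hO hKO
  have hKm' : (μ.prod μ).real (E \ K) ≤ δ / 3 :=
    ENNReal.toReal_le_of_le_ofReal (by positivity) hKm.le
  have hOm' : (μ.prod μ).real (O \ K) ≤ δ / 3 :=
    ENNReal.toReal_le_of_le_ofReal (by positivity) hOm.le
  have hsq : Tendsto (fun n => 1 - (h n * v n) ^ 2) atTop (𝓝 0) := by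
    have := (S.tendsto_mul.pow 2).const_sub 1
    simpa using this
  filter_upwards [S.tendsto_width.eventually_lt_const hη,
    hsq.eventually_lt_const (by positivity : 0 < δ / 3)] with n hn hn'
  set G := Finset.range (h n) ×ˢ Finset.range (h n)
  classical
  refine ⟨G.filter fun p => (I n p.1 ×ˢ I n p.2 ∩ K).Nonempty, Finset.filter_subset _ _, ?_⟩
  have hcompl : (μ.prod μ).real (cellUnion I n G)ᶜ ≤ δ / 3 := by
    rw [probReal_compl_eq_one_sub (S.measurableSet_cellUnion n G),
      S.measureReal_cellUnion (Finset.Subset.refl _)]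
    rw [Finset.card_product, Finset.card_range]
    push_cast
    nlinarith
  have hsub : E ∆ cellUnion I n (G.filter fun p => (I n p.1 ×ˢ I n p.2 ∩ K).Nonempty) ⊆
      (E \ K ∪ O \ K) ∪ (cellUnion I n G)ᶜ := by
    rintro z (⟨hzE, hzU⟩ | ⟨hzU, hzE⟩)
    · by_cases hzK : z ∈ K
      · right
        intro hzG
        apply hzU
        simp only [cellUnion, Set.mem_iUnion, exists_prop, Finset.mem_filter] at hzG ⊢
        obtain ⟨p, hp, hz⟩ := hzG
        exact ⟨p, ⟨hp, z, hz, hzK⟩, hz⟩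
      · exact Or.inl (Or.inl ⟨hzE, hzK⟩)
    · simp only [cellUnion, Set.mem_iUnion, exists_prop, Finset.mem_filter] at hzU
      obtain ⟨p, ⟨-, y, hy, hyK⟩, hz⟩ := hzU
      refine Or.inl (Or.inr ⟨hηO ?_, fun hK => hzE (hKE hK)⟩)
      rw [Metric.mem_thickening_iff]
      refine ⟨y, hyK, ?_⟩
      rw [Prod.dist_eq]
      exact max_lt ((S.dist_le _ _ _ hz.1 _ hy.1).trans_lt hn)
        ((S.dist_le _ _ _ hz.2 _ hy.2).trans_lt hn)
  refine (measureReal_mono hsub).trans ?_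
  refine (measureReal_union_le _ _).trans ?_
  linarith [measureReal_union_le (μ := μ.prod μ) (E \ K) (O \ K)]

end IsColumnSystem

-- Equality of measures turns `P ⊆ R ⁻¹' Q` into equality almost everywhere, so that an invariant
-- set has the same mass in `P` and `Q`.
open MeasureTheory Filter symmDiff in
theorem measureReal_inter_eq_of_subset_preimage {X : Type*} [MeasurableSpace X] {ν : Measure X}
    [IsFiniteMeasure ν] {R : X → X} (hR : MeasurePreserving R ν ν) {P Q E : Set X}
    (hP : MeasurableSet P) (hQ : MeasurableSet Q) (hE : MeasurableSet E)
    (hPQ : P ⊆ R ⁻¹' Q) (heq : ν.real P = ν.real Q) (hinv : R ⁻¹' E =ᵐ[ν] E) :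
    ν.real (E ∩ P) = ν.real (E ∩ Q) := by
  have hPQ' : P =ᵐ[ν] R ⁻¹' Q := by
    refine ae_eq_of_subset_of_measure_ge hPQ ?_ hP.nullMeasurableSet (measure_ne_top _ _)
    rw [hR.measure_preimage hQ.nullMeasurableSet]
    rw [measureReal_def, measureReal_def,
      ENNReal.toReal_eq_toReal_iff' (measure_ne_top _ _) (measure_ne_top _ _)] at heq
    exact heq.ge
  rw [← hR.measureReal_preimage (hE.inter hQ).nullMeasurableSet, Set.preimage_inter]
  exact measureReal_congr (hinv.symm.inter hPQ')

/-! ### From partial returns to ergodicity of the square. -/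

namespace IsColumnSystem

open MeasureTheory Filter Topology symmDiff

variable {T : ℝ → ℝ} {μ : Measure ℝ} {h : ℕ → ℕ} {I : ℕ → ℕ → Set ℝ} {v w : ℕ → ℝ}

theorem tendsto_sub_one_mul (S : IsColumnSystem T μ h I v w) :
    Tendsto (fun n => 1 - (((h n - 1 : ℕ) : ℝ) * v n) ^ 2) atTop (𝓝 0) := by
  have h1 : Tendsto (fun n => ((h n - 1 : ℕ) : ℝ) * v n) atTop (𝓝 1) := by
    have h2 : Tendsto (fun n => h n * v n - v n) atTop (𝓝 1) := by
      simpa using S.tendsto_mul.sub S.tendsto_measure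
    refine h2.congr' ?_
    filter_upwards [Tendsto.eventually_const_lt zero_lt_one S.tendsto_mul] with n hn
    have : 1 ≤ h n := by
      by_contra! hlt
      have : h n = 0 := by omega
      simp [this] at hn
    rw [Nat.cast_sub this]
    push_cast
    ring
  simpa using (h1.pow 2).const_sub 1

variable [IsProbabilityMeasure μ]

/-- A union of cells nearly invariant under `(T × T)^N` is nearly invariant under `T × id`, when
definite proportions of all levels return to themselves and to the next level at time `N`. -/
theorem measureReal_symmDiff_map_id_le (S : IsColumnSystem T μ h I v w) {c : ℝ} (hc : 0 < c)
    {n N : ℕ} {A A' : ℕ → Set ℝ}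
    (hA : ∀ j, j + 1 < h n → A j ⊆ I n j ∧ MeasurableSet (A j) ∧ c * v n ≤ μ.real (A j) ∧
      ∀ x ∈ A j, T^[N] x ∈ I n (j + 1))
    (hA' : ∀ j, j + 1 < h n → A' j ⊆ I n j ∧ MeasurableSet (A' j) ∧ c * v n ≤ μ.real (A' j) ∧
      ∀ x ∈ A' j, T^[N] x ∈ I n j)
    {J : Finset (ℕ × ℕ)} (hJ : J ⊆ Finset.range (h n) ×ˢ Finset.range (h n)) :
    (μ.prod μ).real (cellUnion I n J ∆ (Prod.map T id ⁻¹' cellUnion I n J)) ≤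
      (μ.prod μ).real (cellUnion I n J ∆ ((Prod.map T T)^[N] ⁻¹' cellUnion I n J)) / c ^ 2 +
        (1 - (((h n - 1 : ℕ) : ℝ) * v n) ^ 2) := by
  classical
  set U := cellUnion I n J with hU
  set D := U ∆ (Prod.map T id ⁻¹' U) with hD
  -- Top levels are left out, as the column does not say where they go; they account for the last
  -- term of the bound.
  set G := Finset.range (h n - 1) ×ˢ Finset.range (h n - 1) with hG
  -- The cells whose membership in the union changes when the first coordinate moves up one level.
  set J' := G.filter fun p => Xor (p ∈ J) ((p.1 + 1, p.2) ∈ J) with hJ'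
  have hGsub : G ⊆ Finset.range (h n) ×ˢ Finset.range (h n) :=
    Finset.product_subset_product (Finset.range_mono (Nat.sub_le _ _))
      (Finset.range_mono (Nat.sub_le _ _))
  have hJG : J' ⊆ G := Finset.filter_subset _ _
  have hmemG : ∀ p ∈ G, p.1 + 1 < h n ∧ p.2 + 1 < h n := by
    intro p hp
    simp only [hG, Finset.mem_product, Finset.mem_range] at hp
    omega
  have hDcell : ∀ p ∈ G, ∀ z : ℝ × ℝ, z.1 ∈ I n p.1 → z.2 ∈ I n p.2 →
      (z ∈ D ↔ Xor (p ∈ J) ((p.1 + 1, p.2) ∈ J)) := by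
    intro p hp z h1 h2
    obtain ⟨hp1, hp2⟩ := hmemG p hp
    have e1 : z ∈ U ↔ p ∈ J := S.mem_cellUnion_iff hJ (by omega) (by omega) h1 h2
    have e2 : Prod.map T id z ∈ U ↔ (p.1 + 1, p.2) ∈ J :=
      S.mem_cellUnion_iff hJ hp1 (by omega) (S.step n _ _ hp1 h1) h2
    rw [hD, Set.mem_symmDiff, Set.mem_preimage, e1, e2]
    rfl
  have hcover : D ⊆ cellUnion I n J' ∪ (cellUnion I n G)ᶜ := by
    intro z hz
    by_cases hzG : z ∈ cellUnion I n G
    · left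
      simp only [cellUnion, Set.mem_iUnion, exists_prop] at hzG ⊢
      obtain ⟨p, hp, h1, h2⟩ := hzG
      exact ⟨p, Finset.mem_filter.2 ⟨hp, (hDcell p hp z h1 h2).1 hz⟩, h1, h2⟩
    · exact Or.inr hzG
  have hcompl : (μ.prod μ).real (cellUnion I n G)ᶜ ≤ 1 - (((h n - 1 : ℕ) : ℝ) * v n) ^ 2 := by
    rw [probReal_compl_eq_one_sub (S.measurableSet_cellUnion n G),
      S.measureReal_cellUnion hGsub, hG, Finset.card_product, Finset.card_range]
    push_cast
    nlinarith
  -- On `A j × A' k` the `N`-th iterate acts on cells as `T × id` does: it goes to cell `(j + 1,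
  -- k)`. Each cell of `J'` thus contributes at least `(c v)^2` to the defect of invariance under
  -- the iterate.
  have hinter : (⋃ p ∈ J', A p.1 ×ˢ A' p.2) ⊆ U ∆ ((Prod.map T T)^[N] ⁻¹' U) := by
    intro z hz
    simp only [Set.mem_iUnion, exists_prop, Set.mem_prod] at hz
    obtain ⟨p, hp, h1, h2⟩ := hz
    obtain ⟨hpG, hx⟩ := Finset.mem_filter.1 hp
    obtain ⟨hp1, hp2⟩ := hmemG p hpG
    have e1 : z ∈ U ↔ p ∈ J := S.mem_cellUnion_iff hJ (by omega) (by omega)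
      ((hA _ hp1).1 h1) ((hA' _ hp2).1 h2)
    have e2 : (Prod.map T T)^[N] z ∈ U ↔ (p.1 + 1, p.2) ∈ J := by
      rw [Prod.map_iterate]
      exact S.mem_cellUnion_iff hJ hp1 (by omega) ((hA _ hp1).2.2.2 _ h1)
        ((hA' _ hp2).2.2.2 _ h2)
    rw [Set.mem_symmDiff, Set.mem_preimage, e1, e2]
    exact hx
  have hcard : J'.card * (c * v n) ^ 2 ≤
      (μ.prod μ).real (U ∆ ((Prod.map T T)^[N] ⁻¹' U)) := by
    refine le_trans ?_ (measureReal_mono hinter)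
    rw [measureReal_biUnion_finset]
    · rw [← nsmul_eq_mul, ← Finset.sum_const]
      refine Finset.sum_le_sum fun p hp => ?_
      obtain ⟨hp1, hp2⟩ := hmemG p (hJG hp)
      have hv : 0 ≤ v n := by
        rw [← S.measure_eq n p.1 (by omega)]; exact measureReal_nonneg
      rw [measureReal_prod_prod, sq]
      exact mul_le_mul (hA _ hp1).2.2.1 (hA' _ hp2).2.2.1 (by positivity) measureReal_nonneg
    · intro p hp p' hp' hne
      obtain ⟨hp1, hp2⟩ := hmemG p (hJG hp)
      obtain ⟨hp1', hp2'⟩ := hmemG p' (hJG hp')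
      exact (S.pairwiseDisjoint_cell (hJG.trans hGsub) hp hp' hne).mono
        (Set.prod_mono (hA _ hp1).1 (hA' _ hp2).1) (Set.prod_mono (hA _ hp1').1 (hA' _ hp2').1)
    · intro p hp
      obtain ⟨hp1, hp2⟩ := hmemG p (hJG hp)
      exact (hA _ hp1).2.1.prod (hA' _ hp2).2.1
  refine (measureReal_mono hcover).trans ((measureReal_union_le _ _).trans ?_)
  refine add_le_add ?_ hcompl
  rw [S.measureReal_cellUnion (hJG.trans hGsub), le_div_iff₀ (by positivity)]
  calc _ = J'.card * (c * v n) ^ 2 := by ring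
    _ ≤ _ := hcard

/-- The hypothesis that, at some time, definite proportions of all levels of a column (but the
top one) are sent to themselves and to the next level. -/
def HasPartialReturns (T : ℝ → ℝ) (μ : Measure ℝ) (h : ℕ → ℕ) (I : ℕ → ℕ → Set ℝ)
    (v : ℕ → ℝ) (c : ℝ) : Prop :=
  ∀ n, ∃ (N : ℕ) (A A' : ℕ → Set ℝ),
    (∀ j, j + 1 < h n → A j ⊆ I n j ∧ MeasurableSet (A j) ∧ c * v n ≤ μ.real (A j) ∧
      ∀ x ∈ A j, T^[N] x ∈ I n (j + 1)) ∧
    (∀ j, j + 1 < h n → A' j ⊆ I n j ∧ MeasurableSet (A' j) ∧ c * v n ≤ μ.real (A' j) ∧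
      ∀ x ∈ A' j, T^[N] x ∈ I n j)

/-- Approximate `E` by cells within `δ`. Invariance of `E` makes the union of cells `2δ`-invariant
under every iterate of `T × T`, whatever the return time; the partial returns convert this to `T ×
id`, and all errors are multiples of `δ`. -/
theorem preimage_map_id_ae_eq (S : IsColumnSystem T μ h I v w) {c : ℝ} (hc : 0 < c)
    (hR : HasPartialReturns T μ h I v c) {E : Set (ℝ × ℝ)} (hE : MeasurableSet E)
    (hinv : Prod.map T T ⁻¹' E = E) :
    Prod.map T id ⁻¹' E =ᵐ[μ.prod μ] E := by
  have hTT : MeasurePreserving (Prod.map T T) (μ.prod μ) (μ.prod μ) :=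
    S.measurePreserving.prod S.measurePreserving
  have hTi : MeasurePreserving (Prod.map T id) (μ.prod μ) (μ.prod μ) :=
    S.measurePreserving.prod (MeasurePreserving.id μ)
  have hle : ∀ δ > 0, (μ.prod μ).real (E ∆ (Prod.map T id ⁻¹' E)) ≤
      (2 + 2 / c ^ 2 + 1) * δ := by
    intro δ hδ
    obtain ⟨n, ⟨J, hJ, hJδ⟩, hn⟩ := ((S.exists_cellUnion_approx hE hδ).and
      (S.tendsto_sub_one_mul.eventually_lt_const hδ)).exists
    obtain ⟨N, A, A', hA, hA'⟩ := hR n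
    have h1 := S.measureReal_symmDiff_map_id_le hc hA hA' hJ
    set U := cellUnion I n J
    have hUm : MeasurableSet U := S.measurableSet_cellUnion n J
    have h2 : (μ.prod μ).real (U ∆ ((Prod.map T T)^[N] ⁻¹' U)) ≤ 2 * δ := by
      have hEN : (Prod.map T T)^[N] ⁻¹' E = E := by
        clear h1 hA hA'
        induction N with
        | zero => simp
        | succ N ih => rw [Function.iterate_succ, Set.preimage_comp, ih, hinv]
      have h3 : (μ.prod μ).real (E ∆ ((Prod.map T T)^[N] ⁻¹' U)) =
          (μ.prod μ).real (E ∆ U) := by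
        conv_lhs => rw [← hEN]
        rw [← Set.preimage_symmDiff]
        exact (hTT.iterate N).measureReal_preimage (hE.symmDiff hUm).nullMeasurableSet
      have h4 := measureReal_symmDiff_le (μ := μ.prod μ) (s := U) (t := E)
        ((Prod.map T T)^[N] ⁻¹' U)
      rw [h3, symmDiff_comm U E] at h4
      linarith
    have h5 : (μ.prod μ).real ((Prod.map T id ⁻¹' U) ∆ (Prod.map T id ⁻¹' E)) ≤ δ := by
      rw [← Set.preimage_symmDiff, hTi.measureReal_preimage (hUm.symmDiff hE).nullMeasurableSet,
        symmDiff_comm]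
      exact hJδ
    have h6 := measureReal_symmDiff_le (μ := μ.prod μ) (s := E) (t := U) (Prod.map T id ⁻¹' E)
    have h7 := measureReal_symmDiff_le (μ := μ.prod μ) (s := U) (t := Prod.map T id ⁻¹' U)
      (Prod.map T id ⁻¹' E)
    have h8 := div_le_div_of_nonneg_right h2 (sq_nonneg c)
    have : (2 + 2 / c ^ 2 + 1) * δ = 2 * δ + 2 * δ / c ^ 2 + δ := by ring
    linarith
  have hzero : (μ.prod μ).real (E ∆ (Prod.map T id ⁻¹' E)) = 0 := by
    refine le_antisymm ?_ measureReal_nonneg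
    refine le_of_forall_pos_le_add fun δ hδ => ?_
    have hC : 0 < 2 + 2 / c ^ 2 + 1 := by positivity
    refine (hle (δ / (2 + 2 / c ^ 2 + 1)) (by positivity)).trans ?_
    rw [mul_div_cancel₀ _ hC.ne', zero_add]
  rw [measureReal_eq_zero_iff] at hzero
  exact (measure_symmDiff_eq_zero_iff.1 hzero).symm

theorem measureReal_inter_cell_eq (S : IsColumnSystem T μ h I v w) {E : Set (ℝ × ℝ)}
    (hE : MeasurableSet E) (hinv : Prod.map T T ⁻¹' E = E)
    (hinv' : Prod.map T id ⁻¹' E =ᵐ[μ.prod μ] E) (n : ℕ) {j j' : ℕ} (hj : j < h n)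
    (hj' : j' < h n) :
    (μ.prod μ).real (E ∩ I n j ×ˢ I n j') = (μ.prod μ).real (E ∩ I n 0 ×ˢ I n 0) := by
  have hTT : MeasurePreserving (Prod.map T T) (μ.prod μ) (μ.prod μ) :=
    S.measurePreserving.prod S.measurePreserving
  have hTi : MeasurePreserving (Prod.map T id) (μ.prod μ) (μ.prod μ) :=
    S.measurePreserving.prod (MeasurePreserving.id μ)
  have hm : ∀ i i', MeasurableSet (I n i ×ˢ I n i') := fun i i' =>
    (S.measurableSet n i).prod (S.measurableSet n i')
  have hleft : ∀ i i', i < h n → i' < h n →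
      (μ.prod μ).real (E ∩ I n i ×ˢ I n i') = (μ.prod μ).real (E ∩ I n 0 ×ˢ I n i') := by
    intro i i' hi hi'
    induction i with
    | zero => rfl
    | succ i ih =>
      rw [← ih (by omega)]
      symm
      refine measureReal_inter_eq_of_subset_preimage hTi (hm _ _) (hm _ _) hE ?_ ?_ hinv'
      · exact fun z hz => ⟨S.step n i _ hi hz.1, hz.2⟩
      · simp only [measureReal_prod_prod]
        rw [S.measure_eq n i (by omega), S.measure_eq n (i + 1) hi]
  rw [hleft j j' hj hj']
  clear hj
  induction j' with
  | zero => rfl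
  | succ i ih =>
    -- `T × T` takes cell `(0, i)` to `(1, i + 1)`, and invariance under `T × id` brings this back
    -- to `(0, i + 1)`.
    rw [← ih (by omega), ← hleft 1 (i + 1) (by omega) hj']
    symm
    refine measureReal_inter_eq_of_subset_preimage hTT (hm _ _) (hm _ _) hE ?_ ?_
      (Filter.EventuallyEq.of_eq hinv)
    · exact fun z hz => ⟨S.step n 0 _ (by omega) hz.1, S.step n i _ hj' hz.2⟩
    · simp only [measureReal_prod_prod]
      rw [S.measure_eq n _ (by omega), S.measure_eq n _ (by omega), S.measure_eq n _ (by omega),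
        S.measure_eq n _ (by omega)]

/-- All cells of a column carry the same mass of `E`, while `E` is nearly a union of cells.
Comparing this union with the whole column gives `e = e ^ 2` in the limit, where `e` is the measure
of `E`. -/
theorem ergodic_prodMap (S : IsColumnSystem T μ h I v w) {c : ℝ} (hc : 0 < c)
    (hR : HasPartialReturns T μ h I v c) : Ergodic (Prod.map T T) (μ.prod μ) := by
  refine ⟨S.measurePreserving.prod S.measurePreserving, ⟨fun E hE hinv => ?_⟩⟩
  have hinv' := S.preimage_map_id_ae_eq hc hR hE hinv
  set e := (μ.prod μ).real E with he
  have he0 : 0 ≤ e := measureReal_nonneg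
  have he1 : e ≤ 1 := measureReal_le_one
  have hle : ∀ δ > 0, δ ≤ 1 → |e - e ^ 2| ≤ 8 * δ := by
    intro δ hδ hδ1
    have hsq : Tendsto (fun n => 1 - (h n * v n) ^ 2) atTop (𝓝 0) := by
      simpa using (S.tendsto_mul.pow 2).const_sub 1
    obtain ⟨n, ⟨J, hJ, hJδ⟩, hn⟩ := ((S.exists_cellUnion_approx hE hδ).and
      (hsq.eventually_lt_const hδ)).exists
    set G := Finset.range (h n) ×ˢ Finset.range (h n) with hG
    set a := (μ.prod μ).real (E ∩ I n 0 ×ˢ I n 0)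
    have hsum : ∀ K ⊆ G, (μ.prod μ).real (E ∩ cellUnion I n K) = K.card * a := by
      intro K hK
      rw [S.measureReal_inter_cellUnion hK hE, ← nsmul_eq_mul, ← Finset.sum_const]
      refine Finset.sum_congr rfl fun p hp => ?_
      have := hK hp
      simp only [hG, Finset.mem_product, Finset.mem_range] at this
      exact S.measureReal_inter_cell_eq hE hinv hinv' n this.1 this.2
    have hGc : (μ.prod μ).real (cellUnion I n G) = G.card * v n ^ 2 :=
      S.measureReal_cellUnion (Finset.Subset.refl _)
    have hJc : (μ.prod μ).real (cellUnion I n J) = J.card * v n ^ 2 := S.measureReal_cellUnion hJ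
    have hGt : (μ.prod μ).real (cellUnion I n G) = (h n * v n) ^ 2 := by
      rw [hGc, hG, Finset.card_product, Finset.card_range]
      push_cast
      ring
    -- Equal density in all cells; the two sides tend to `e · 1` and `e · e`.
    have hprod : (μ.prod μ).real (E ∩ cellUnion I n J) * (μ.prod μ).real (cellUnion I n G) =
        (μ.prod μ).real (cellUnion I n J) * (μ.prod μ).real (E ∩ cellUnion I n G) := by
      rw [hsum J hJ, hsum G (Finset.Subset.refl _), hGc, hJc]
      ring
    have hUm := S.measurableSet_cellUnion n J
    have hGm := S.measurableSet_cellUnion n G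
    have hx1 : (μ.prod μ).real (E ∩ cellUnion I n J) ≤ e := measureReal_mono Set.inter_subset_left
    have hx2 : (μ.prod μ).real (E ∩ cellUnion I n J) ≤ (μ.prod μ).real (cellUnion I n J) :=
      measureReal_mono Set.inter_subset_right
    have hz1 : (μ.prod μ).real (E ∩ cellUnion I n G) ≤ e := measureReal_mono Set.inter_subset_left
    have ht1 : (μ.prod μ).real (cellUnion I n G) ≤ 1 := measureReal_le_one
    have hd := measureReal_symmDiff_eq (μ := μ.prod μ) hE hUm
    have hd1 : (μ.prod μ).real (E ∩ cellUnion I n J) + (μ.prod μ).real (E \ cellUnion I n J) = e :=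
      measureReal_inter_add_sdiff hUm
    have hd2 : (μ.prod μ).real (cellUnion I n J ∩ E) + (μ.prod μ).real (cellUnion I n J \ E) =
      (μ.prod μ).real (cellUnion I n J) := measureReal_inter_add_sdiff hE
    have hd3 : (μ.prod μ).real (E ∩ cellUnion I n G) + (μ.prod μ).real (E \ cellUnion I n G) = e :=
      measureReal_inter_add_sdiff hGm
    have hd4 : (μ.prod μ).real (E \ cellUnion I n G) ≤ 1 - (μ.prod μ).real (cellUnion I n G) := by
      rw [← probReal_compl_eq_one_sub hGm]
      exact measureReal_mono fun z hz => hz.2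
    rw [Set.inter_comm] at hd2
    have hp1 : 0 ≤ (μ.prod μ).real (E \ cellUnion I n J) := measureReal_nonneg
    have hp2 : 0 ≤ (μ.prod μ).real (cellUnion I n J \ E) := measureReal_nonneg
    have hp3 : 0 ≤ (μ.prod μ).real (E ∩ cellUnion I n G) := measureReal_nonneg
    have hp4 : 0 ≤ (μ.prod μ).real (E ∩ cellUnion I n J) := measureReal_nonneg
    set x := (μ.prod μ).real (E ∩ cellUnion I n J)
    set y := (μ.prod μ).real (cellUnion I n J)
    set z := (μ.prod μ).real (E ∩ cellUnion I n G)
    set t := (μ.prod μ).real (cellUnion I n G)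
    have ht : 1 - δ ≤ t := by rw [hGt]; linarith
    have hx : e - δ ≤ x := by linarith
    have hy : y ≤ e + δ := by linarith
    have hy' : e - δ ≤ y := by linarith
    have hz : e - δ ≤ z := by linarith
    have hy0 : 0 ≤ y := measureReal_nonneg
    have hxt1 : |x * t - e| ≤ 2 * δ := by
      rw [abs_le]
      constructor <;> nlinarith
    have hyz : |y * z - e ^ 2| ≤ 2 * δ := by
      have h1 : |y - e| ≤ δ := by rw [abs_le]; constructor <;> linarith
      have h2 : |z - e| ≤ δ := by rw [abs_le]; constructor <;> linarith
      have h3 : y * z - e ^ 2 = (y - e) * z + e * (z - e) := by ring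
      rw [h3]
      refine (abs_add_le _ _).trans ?_
      rw [abs_mul, abs_mul, abs_of_nonneg hp3, abs_of_nonneg he0]
      nlinarith [abs_nonneg (y - e), abs_nonneg (z - e)]
    rw [← hprod] at hyz
    have := abs_sub_le e (x * t) (e ^ 2)
    rw [abs_sub_comm e (x * t)] at this
    linarith
  have hee : e - e ^ 2 = 0 := by
    rw [← abs_eq_zero]
    refine le_antisymm ?_ (abs_nonneg _)
    refine le_of_forall_pos_le_add fun δ hδ => ?_
    refine (hle (min (δ / 8) 1) (by positivity) (min_le_right _ _)).trans ?_
    linarith [min_le_left (δ / 8) 1]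
  have hcases : e = 0 ∨ e = 1 := by
    have : e * (1 - e) = 0 := by linarith
    rcases mul_eq_zero.1 this with h | h
    · exact Or.inl h
    · exact Or.inr (by linarith)
  rw [Filter.eventuallyConst_set']
  rcases hcases with h0 | h1
  · left
    rw [he, measureReal_eq_zero_iff] at h0
    exact ae_eq_empty.2 h0
  · right
    rw [ae_eq_univ, ← measureReal_eq_zero_iff, probReal_compl_eq_one_sub hE, ← he, h1, sub_self]

end IsColumnSystem

/-! ## Levels of a cutting and stacking construction -/

/-- Gives access to a list built subcolumn by subcolumn: entry `j` of piece `i` sits at the total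
length of the earlier pieces plus `j`. -/
theorem getD_flatMap_range {α : Type*} (f : ℕ → List α) (d : α) (m i j : ℕ) (hi : i < m)
    (hj : j < (f i).length) :
    ((List.range m).flatMap f).getD ((∑ l ∈ Finset.range i, (f l).length) + j) d =
      (f i).getD j d := by
  have hlen : ∀ m, ((List.range m).flatMap f).length = ∑ l ∈ Finset.range m, (f l).length := by
    intro m
    induction m with
    | zero => simp
    | succ m ih =>
      rw [List.range_succ, List.flatMap_append, List.length_append, ih, Finset.sum_range_succ]
      simp
  induction m with
  | zero => omega
  | succ m ih =>
    rw [List.range_succ, List.flatMap_append, List.flatMap_singleton]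
    rcases Nat.lt_succ_iff_lt_or_eq.1 hi with h | rfl
    · rw [List.getD_append, ih h]
      rw [hlen]
      have := Finset.sum_le_sum_of_subset (f := fun l => (f l).length)
        (Finset.range_mono (Nat.succ_le_of_lt h))
      rw [Finset.sum_range_succ] at this
      omega
    · rw [List.getD_append_right _ _ _ _ (by rw [hlen]; omega), hlen, Nat.add_sub_cancel_left]

namespace RankOneData

variable (D : RankOneData)

/-- The position in the column `n + 1` of the bottom of the `i`-th subcolumn of column `n`. -/
noncomputable def start (n i : ℕ) : ℕ := ∑ l ∈ Finset.range i, (D.height n + D.s n l)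

theorem start_succ (n i : ℕ) : D.start n (i + 1) = D.start n i + (D.height n + D.s n i) :=
  Finset.sum_range_succ _ _

theorem height_zero : D.height 0 = 1 := rfl

theorem height_succ (n : ℕ) : D.height (n + 1) = D.start n (D.r n + 1) := by
  simp only [height, lefts, List.length_flatMap, List.length_append, List.length_map,
    List.length_range, start]
  rfl

theorem start_mono (n : ℕ) : Monotone (D.start n) :=
  monotone_nat_of_le_succ fun i => by rw [start_succ]; omega

theorem start_add_lt {n i j : ℕ} (hi : i ≤ D.r n) (hj : j < D.height n) :
    D.start n i + j < D.height (n + 1) := by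
  rw [height_succ]
  refine lt_of_lt_of_le ?_ (D.start_mono n (Nat.succ_le_succ hi))
  rw [start_succ]
  omega

theorem width_pos (n : ℕ) : 0 < D.width n := by
  induction n with
  | zero => simp [width]
  | succ n ih => rw [width]; positivity

theorem width_eq (n : ℕ) : D.width n = ((D.r n : ℝ) + 1) * D.width (n + 1) := by
  rw [width]; field_simp

theorem two_mul_width_succ_le (n : ℕ) : 2 * D.width (n + 1) ≤ D.width n := by
  have h1 : (1 : ℝ) ≤ D.r n := by exact_mod_cast D.one_le_r n
  rw [D.width_eq n]
  nlinarith [D.width_pos (n + 1)]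

theorem width_le (n : ℕ) : D.width n ≤ (1 / 2) ^ n := by
  induction n with
  | zero => simp [width]
  | succ n ih =>
    rw [pow_succ]
    linarith [D.two_mul_width_succ_le n]

theorem tendsto_width : Filter.Tendsto D.width Filter.atTop (nhds 0) :=
  squeeze_zero (fun n => (D.width_pos n).le) D.width_le
    (tendsto_pow_atTop_nhds_zero_of_lt_one (by norm_num) (by norm_num))

theorem left_start {n i j : ℕ} (hi : i ≤ D.r n) (hj : j < D.height n) :
    D.left (n + 1) (D.start n i + j) = D.left n j + i * D.width (n + 1) := by
  have := getD_flatMap_range (fun (i : ℕ) =>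
      (D.lefts n).map (fun (a : ℝ) => a + (i : ℝ) * D.width (n + 1)) ++
      (List.range (D.s n i)).map (fun (k : ℕ) =>
        ((D.lefts n).length : ℝ) * D.width n +
          (((∑ l ∈ Finset.range i, D.s n l) + k : ℕ) : ℝ) * D.width (n + 1)))
    0 (D.r n + 1) i j (by omega) (by
      simp only [List.length_append, List.length_map]; unfold height at hj; omega)
  simp only [List.length_append, List.length_map, List.length_range] at this
  unfold left start height
  rw [lefts, this, List.getD_append _ _ _ _ (by simpa [height] using hj)]
  unfold height at hj
  rw [List.getD_eq_getElem _ _ (by simpa using hj), List.getD_eq_getElem _ _ hj,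
    List.getElem_map]

/-! ### Integer coordinates of the levels and their disjointness. -/

/-- The indices `k` such that the levels of the `n`-th column are the intervals
`[k w, (k + 1) w)`. -/
noncomputable def indices : ℕ → List ℕ
  | 0 => [0]
  | n + 1 => (List.range (D.r n + 1)).flatMap fun (i : ℕ) =>
      (indices n).map (fun k => k * (D.r n + 1) + i) ++
      (List.range (D.s n i)).map fun k =>
        D.height n * (D.r n + 1) + ((∑ l ∈ Finset.range i, D.s n l) + k)

theorem lefts_eq (n : ℕ) : D.lefts n = (D.indices n).map fun k : ℕ => (k : ℝ) * D.width n := by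
  induction n with
  | zero => simp [lefts, indices]
  | succ n ih =>
    rw [lefts, indices, List.map_flatMap]
    congr 1
    funext i
    rw [List.map_append, List.map_map, List.map_map]
    congr 1
    · rw [ih, List.map_map]
      refine List.map_congr_left fun k _ => ?_
      simp only [Function.comp]
      rw [D.width_eq n]
      push_cast
      ring
    · refine List.map_congr_left fun k _ => ?_
      simp only [Function.comp, height]
      rw [D.width_eq n]
      push_cast
      ring

theorem length_indices (n : ℕ) : (D.indices n).length = D.height n := by
  rw [height, lefts_eq, List.length_map]

theorem start_eq (n i : ℕ) :
    D.start n i = D.height n * i + ∑ l ∈ Finset.range i, D.s n l := by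
  rw [start, Finset.sum_add_distrib]
  simp [mul_comm]

theorem mul_add_lt_mul {a b m i : ℕ} (ha : a < b) (hi : i < m) : a * m + i < b * m := by
  have := Nat.mul_le_mul_right m (Nat.succ_le_of_lt ha)
  rw [Nat.succ_mul] at this
  omega

theorem lt_height_of_mem_indices (n : ℕ) : ∀ k ∈ D.indices n, k < D.height n := by
  induction n with
  | zero => simp [indices, height_zero]
  | succ n ih =>
    intro k hk
    rw [height_succ, start_eq]
    simp only [indices, List.mem_flatMap, List.mem_range, List.mem_append, List.mem_map] at hk
    obtain ⟨i, hi, ⟨a, ha, rfl⟩ | ⟨a, ha, rfl⟩⟩ := hk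
    · exact (mul_add_lt_mul (ih a ha) hi).trans_le (Nat.le_add_right _ _)
    · have := Finset.sum_le_sum_of_subset (f := D.s n)
        (Finset.range_mono (Nat.succ_le_of_lt hi))
      rw [Finset.sum_range_succ] at this
      omega

theorem nodup_indices (n : ℕ) : (D.indices n).Nodup := by
  induction n with
  | zero => simp [indices]
  | succ n ih =>
    rw [indices, List.nodup_flatMap]
    constructor
    · intro i hi
      rw [List.mem_range] at hi
      refine List.Nodup.append ?_ ?_ ?_
      · refine ih.map fun a b hab => ?_
        simp only [add_left_inj] at hab
        exact Nat.eq_of_mul_eq_mul_right (by omega) hab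
      · exact List.nodup_range.map fun a b hab => by simpa using hab
      · intro x hx hx'
        simp only [List.mem_map, List.mem_range] at hx hx'
        obtain ⟨a, ha, rfl⟩ := hx
        obtain ⟨b, hb, hab⟩ := hx'
        have := mul_add_lt_mul (D.lt_height_of_mem_indices n a ha) hi
        omega
    · refine List.nodup_range.pairwise_of_forall_ne fun i hi i' hi' hne => ?_
      rw [List.mem_range] at hi hi'
      intro x hx hx'
      simp only [List.mem_append, List.mem_map, List.mem_range] at hx hx'
      have key : ∀ i a, i < D.r n + 1 → a ∈ D.indices n →
          a * (D.r n + 1) + i < D.height n * (D.r n + 1) := fun i a hi ha =>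
        mul_add_lt_mul (D.lt_height_of_mem_indices n a ha) hi
      have key' : ∀ i i' b b', i < i' → b < D.s n i →
          (∑ l ∈ Finset.range i, D.s n l) + b ≠ (∑ l ∈ Finset.range i', D.s n l) + b' := by
        intro i i' b b' hii hb
        have := Finset.sum_le_sum_of_subset (f := D.s n) (Finset.range_mono (Nat.succ_le_of_lt hii))
        rw [Finset.sum_range_succ] at this
        omega
      rcases hx with ⟨a, ha, rfl⟩ | ⟨b, hb, rfl⟩ <;> rcases hx' with ⟨a', ha', h⟩ | ⟨b', hb', h⟩
      -- Pieces of old levels in different subcolumns differ modulo `r n + 1`; the next cases use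
      -- that spacers lie beyond all old levels.
      · have := congrArg (· % (D.r n + 1)) h
        simp only [Nat.mul_add_mod_self_right, Nat.mod_eq_of_lt hi, Nat.mod_eq_of_lt hi'] at this
        exact hne this.symm
      · have := key i a hi ha
        omega
      · have := key i' a' hi' ha'
        omega
      · rcases lt_or_gt_of_ne hne with hlt | hlt
        · exact key' i i' b b' hlt hb (by omega)
        · exact key' i' i b' b hlt hb' (by omega)

theorem left_eq {n j : ℕ} (hj : j < D.height n) :
    D.left n j = ((D.indices n).getD j 0 : ℕ) * D.width n := by
  have hj' : j < (D.indices n).length := by rwa [length_indices]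
  rw [left, lefts_eq, List.getD_eq_getElem _ _ (by simpa using hj'), List.getElem_map,
    List.getD_eq_getElem _ _ hj']

theorem eq_of_mem_level {n j k : ℕ} {x : ℝ} (hj : j < D.height n) (hk : k < D.height n)
    (hxj : x ∈ D.level n j) (hxk : x ∈ D.level n k) : j = k := by
  have hj' : j < (D.indices n).length := by rwa [length_indices]
  have hk' : k < (D.indices n).length := by rwa [length_indices]
  rw [level, D.left_eq hj, Set.mem_Ico] at hxj
  rw [level, D.left_eq hk, Set.mem_Ico] at hxk
  have hw := D.width_pos n
  have hlt : ∀ a b : ℕ, (a : ℝ) * D.width n ≤ x → x < b * D.width n + D.width n → a ≤ b := by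
    intro a b ha hb
    have : (a : ℝ) < b + 1 := by
      by_contra! h
      nlinarith
    exact Nat.lt_succ_iff.1 (by exact_mod_cast this)
  have := le_antisymm (hlt _ _ hxj.1 hxk.2) (hlt _ _ hxk.1 hxj.2)
  rw [List.getD_eq_getElem _ _ hj', List.getD_eq_getElem _ _ hk'] at this
  exact ((D.nodup_indices n).getElem_inj_iff).1 this

theorem level_start_subset {n i j : ℕ} (hi : i ≤ D.r n) (hj : j < D.height n) :
    D.level (n + 1) (D.start n i + j) ⊆ D.level n j := by
  intro x hx
  rw [level, D.left_start hi hj, Set.mem_Ico] at hx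
  have hw := D.width_pos (n + 1)
  have h1 : (i : ℝ) ≤ D.r n := by exact_mod_cast hi
  have h0 : (0 : ℝ) ≤ i := by positivity
  rw [level, Set.mem_Ico, D.width_eq n]
  constructor <;> nlinarith

theorem exists_mem_level_start {n j : ℕ} {x : ℝ} (hj : j < D.height n) (hx : x ∈ D.level n j) :
    ∃ i ≤ D.r n, x ∈ D.level (n + 1) (D.start n i + j) := by
  have hw := D.width_pos (n + 1)
  rw [level, Set.mem_Ico, D.width_eq n] at hx
  have hnn : 0 ≤ (x - D.left n j) / D.width (n + 1) := div_nonneg (by linarith) hw.le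
  have hi : ⌊(x - D.left n j) / D.width (n + 1)⌋₊ ≤ D.r n := by
    rw [← Nat.lt_succ_iff, Nat.floor_lt hnn, div_lt_iff₀ hw]
    push_cast
    linarith
  refine ⟨_, hi, ?_⟩
  rw [level, D.left_start hi hj, Set.mem_Ico]
  have h1 := Nat.floor_le hnn
  have h2 := Nat.lt_floor_add_one ((x - D.left n j) / D.width (n + 1))
  rw [le_div_iff₀ hw] at h1
  rw [div_lt_iff₀ hw] at h2
  constructor <;> linarith

/-- Cutting preserves the translation to the next level, since both levels are shifted by the same
amount within a subcolumn. Any two columns can therefore be compared in a later one, which makes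
`Step` single-valued. -/
theorem exists_level_of_le {n m j : ℕ} {x : ℝ} (hnm : n ≤ m) (hj : j + 1 < D.height n)
    (hx : x ∈ D.level n j) : ∃ k, k + 1 < D.height m ∧ x ∈ D.level m k ∧
      D.left m (k + 1) - D.left m k = D.left n (j + 1) - D.left n j := by
  induction m, hnm using Nat.le_induction with
  | base => exact ⟨j, hj, hx, rfl⟩
  | succ m _ ih =>
    obtain ⟨k, hk, hxk, hd⟩ := ih
    obtain ⟨i, hi, hxi⟩ := D.exists_mem_level_start (by omega) hxk
    refine ⟨D.start m i + k, ?_, hxi, ?_⟩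
    · rw [add_assoc]; exact D.start_add_lt hi hk
    · rw [add_assoc, D.left_start hi hk, D.left_start hi (by omega), ← hd]
      ring

theorem step_unique {y z z' : ℝ} (h : D.Step y z) (h' : D.Step y z') : z = z' := by
  obtain ⟨n, j, hj, hy, rfl⟩ := h
  obtain ⟨n', j', hj', hy', rfl⟩ := h'
  obtain ⟨k, hk, hyk, hd⟩ := D.exists_level_of_le (le_max_left n n') hj hy
  obtain ⟨k', hk', hyk', hd'⟩ := D.exists_level_of_le (le_max_right n n') hj' hy'
  obtain rfl := D.eq_of_mem_level (by omega) (by omega) hyk hyk'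
  rw [← hd, ← hd']

theorem transformation_eq_of_step {y z : ℝ} (h : D.Step y z) : D.transformation y = z := by
  have hex : ∃ z, D.Step y z := ⟨z, h⟩
  rw [transformation, dif_pos hex]
  exact D.step_unique hex.choose_spec h

theorem transformation_of_mem_level {n j : ℕ} {x : ℝ} (hj : j + 1 < D.height n)
    (hx : x ∈ D.level n j) :
    D.transformation x = x + (D.left n (j + 1) - D.left n j) :=
  D.transformation_eq_of_step ⟨n, j, hj, hx, rfl⟩

theorem transformation_mem_level {n j : ℕ} {x : ℝ} (hj : j + 1 < D.height n)
    (hx : x ∈ D.level n j) : D.transformation x ∈ D.level n (j + 1) := by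
  rw [D.transformation_of_mem_level hj hx]
  rw [level, Set.mem_Ico] at hx ⊢
  constructor <;> linarith

theorem iterate_transformation_mem_level {n k m : ℕ} {x : ℝ} (hk : k + m < D.height n)
    (hx : x ∈ D.level n k) : D.transformation^[m] x ∈ D.level n (k + m) := by
  induction m with
  | zero => exact hx
  | succ m ih =>
    rw [Function.iterate_succ_apply', ← add_assoc]
    exact D.transformation_mem_level (by omega) (ih (by omega))

/-- Without a spacer the next subcolumn starts `height n` levels higher, so one step more gains one
level; a spacer absorbs that step in `iterate_mem_of_spacer_eq_one`. The bound `i < r n` ensures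
that a next subcolumn exists. -/
theorem iterate_mem_of_spacer_eq_zero {n i j : ℕ} {x : ℝ} (hi : i < D.r n) (hs : D.s n i = 0)
    (hj : j + 1 < D.height n) (hx : x ∈ D.level (n + 1) (D.start n i + j)) :
    D.transformation^[D.height n + 1] x ∈ D.level n (j + 1) := by
  have h1 : D.start n i + j + (D.height n + 1) = D.start n (i + 1) + (j + 1) := by
    rw [start_succ, hs]; ring
  refine D.level_start_subset (i := i + 1) hi hj ?_
  rw [← h1]
  exact D.iterate_transformation_mem_level (by rw [h1]; exact D.start_add_lt hi hj) hx

theorem iterate_mem_of_spacer_eq_one {n i j : ℕ} {x : ℝ} (hi : i < D.r n) (hs : D.s n i = 1)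
    (hj : j < D.height n) (hx : x ∈ D.level (n + 1) (D.start n i + j)) :
    D.transformation^[D.height n + 1] x ∈ D.level n j := by
  have h1 : D.start n i + j + (D.height n + 1) = D.start n (i + 1) + j := by
    rw [start_succ, hs]; ring
  refine D.level_start_subset (i := i + 1) hi hj ?_
  rw [← h1]
  exact D.iterate_transformation_mem_level (by rw [h1]; exact D.start_add_lt hi hj) hx

end RankOneData

/-! ## Weak mixing of rank-one transformations with partial returns -/

namespace RankOneData

open MeasureTheory Filter Topology

variable (D : RankOneData)

/-- The union of the levels of the `n`-th column. -/
noncomputable def column (n : ℕ) : Set ℝ := ⋃ j ∈ Finset.range (D.height n), D.level n j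

theorem mem_column {n : ℕ} {x : ℝ} : x ∈ D.column n ↔ ∃ j < D.height n, x ∈ D.level n j := by
  simp [column]

theorem space_eq : D.space = ⋃ n, D.column n := by
  simp [space, column]

theorem measurableSet_level (n j : ℕ) : MeasurableSet (D.level n j) := measurableSet_Ico

theorem measurableSet_column (n : ℕ) : MeasurableSet (D.column n) :=
  Finset.measurableSet_biUnion _ fun _ _ => D.measurableSet_level _ _

theorem level_subset_column {n j : ℕ} (hj : j < D.height n) : D.level n j ⊆ D.column n :=
  fun _ hx => D.mem_column.2 ⟨j, hj, hx⟩

theorem column_subset_space (n : ℕ) : D.column n ⊆ D.space := by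
  rw [space_eq]
  exact Set.subset_iUnion _ n

theorem monotone_column : Monotone D.column := by
  refine monotone_nat_of_le_succ fun n x hx => ?_
  obtain ⟨j, hj, hx⟩ := D.mem_column.1 hx
  obtain ⟨i, hi, hx⟩ := D.exists_mem_level_start hj hx
  exact D.mem_column.2 ⟨_, D.start_add_lt hi hj, hx⟩

theorem volume_level (n j : ℕ) : volume (D.level n j) = ENNReal.ofReal (D.width n) := by
  rw [level, Real.volume_Ico, add_sub_cancel_left]

theorem pairwiseDisjoint_level (n : ℕ) :
    ((Finset.range (D.height n) : Finset ℕ) : Set ℕ).PairwiseDisjoint (D.level n) := by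
  intro j hj k hk hne
  simp only [Finset.coe_range, Set.mem_Iio] at hj hk
  exact Set.disjoint_left.2 fun x hx hx' => hne (D.eq_of_mem_level hj hk hx hx')

theorem volume_column (n : ℕ) :
    volume (D.column n) = ENNReal.ofReal (D.height n * D.width n) := by
  rw [column, measure_biUnion_finset (D.pairwiseDisjoint_level n)
    fun _ _ => D.measurableSet_level _ _]
  simp only [volume_level, Finset.sum_const, Finset.card_range, nsmul_eq_mul]
  rw [ENNReal.ofReal_mul (by positivity), ENNReal.ofReal_natCast]

theorem tendsto_volume_column :
    Tendsto (fun n => volume (D.column n)) atTop (𝓝 (volume D.space)) := by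
  rw [space_eq]
  exact tendsto_measure_iUnion_atTop D.monotone_column

theorem volume_space_pos : 0 < volume D.space := by
  refine lt_of_lt_of_le ?_ (measure_mono (D.column_subset_space 0))
  rw [volume_column, ENNReal.ofReal_pos, height_zero]
  have := D.width_pos 0
  positivity

/-- Spacers of height at most one add at most `w_n` to the measure of the column. The term `2w_n`
makes the induction close, because `2w_{n+1} ≤ w_n`. -/
theorem height_mul_width_le (hs : ∀ n i, D.s n i ≤ 1) (n : ℕ) :
    D.height n * D.width n + 2 * D.width n ≤ 3 := by
  induction n with
  | zero => norm_num [height_zero, width]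
  | succ n ih =>
    have h1 : D.height (n + 1) ≤ (D.r n + 1) * (D.height n + 1) := by
      rw [height_succ, start]
      refine (Finset.sum_le_card_nsmul _ _ (D.height n + 1) fun i _ => ?_).trans ?_
      · exact Nat.add_le_add_left (hs n i) _
      · simp
    have h2 : (D.height (n + 1) : ℝ) ≤ (D.r n + 1) * (D.height n + 1) := by exact_mod_cast h1
    have h3 := mul_le_mul_of_nonneg_right h2 (D.width_pos (n + 1)).le
    have h4 := D.two_mul_width_succ_le n
    have h5 : ((D.r n : ℝ) + 1) * (D.height n + 1) * D.width (n + 1) =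
        D.height n * D.width n + D.width n := by
      rw [D.width_eq n]; ring
    linarith

theorem volume_space_lt_top (hs : ∀ n i, D.s n i ≤ 1) : volume D.space < ⊤ := by
  refine lt_of_le_of_lt (b := ENNReal.ofReal 3) ?_ ENNReal.ofReal_lt_top
  refine le_of_tendsto' D.tendsto_volume_column fun n => ?_
  rw [volume_column]
  exact ENNReal.ofReal_le_ofReal (by linarith [D.height_mul_width_le hs n, D.width_pos n])

/-! ### Measurability of the transformation and invariance of the measure. -/

theorem transformation_of_not_mem {x : ℝ}
    (hx : x ∉ ⋃ (n : ℕ) (j : ℕ) (_ : j + 1 < D.height n), D.level n j) :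
    D.transformation x = x := by
  rw [transformation, dif_neg]
  rintro ⟨z, n, j, hj, hx', -⟩
  simp only [Set.mem_iUnion, not_exists] at hx
  exact hx n j hj hx'

theorem measurable_transformation : Measurable D.transformation := by
  intro A hA
  set N := ⋃ (n : ℕ) (j : ℕ) (_ : j + 1 < D.height n), D.level n j with hN
  have hNm : MeasurableSet N := MeasurableSet.iUnion fun n => MeasurableSet.iUnion fun j =>
    MeasurableSet.iUnion fun _ => D.measurableSet_level n j
  have : D.transformation ⁻¹' A = (⋃ (n : ℕ) (j : ℕ) (_ : j + 1 < D.height n),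
      D.level n j ∩ (fun x => x + (D.left n (j + 1) - D.left n j)) ⁻¹' A) ∪ (Nᶜ ∩ A) := by
    ext x
    by_cases hx : x ∈ N
    · have hx' := hx
      simp only [hN, Set.mem_iUnion] at hx'
      obtain ⟨n, j, hj, hxj⟩ := hx'
      simp only [Set.mem_preimage, Set.mem_union, Set.mem_inter_iff, Set.mem_compl_iff, hx,
        not_true_eq_false, false_and, or_false, Set.mem_iUnion]
      constructor
      · intro h
        rw [D.transformation_of_mem_level hj hxj] at h
        exact ⟨n, j, hj, hxj, h⟩
      · rintro ⟨n, j, hj, hxj, h⟩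
        rwa [D.transformation_of_mem_level hj hxj]
    · rw [Set.mem_preimage, D.transformation_of_not_mem hx]
      simp only [Set.mem_union, Set.mem_inter_iff, Set.mem_compl_iff, hx, not_false_eq_true,
        true_and, Set.mem_iUnion]
      refine ⟨Or.inr, fun h => h.resolve_left ?_⟩
      rintro ⟨n, j, hj, hxj, -⟩
      apply hx
      simp only [hN, Set.mem_iUnion]
      exact ⟨n, j, hj, hxj⟩
  rw [this]
  refine MeasurableSet.union (MeasurableSet.iUnion fun n => MeasurableSet.iUnion fun j =>
    MeasurableSet.iUnion fun _ => ?_) (hNm.compl.inter hA)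
  exact (D.measurableSet_level n j).inter ((measurable_add_const _) hA)

/-- Below the top level the map is a translation of disjoint levels onto disjoint levels; the top
level costs at most its width, which vanishes in the limit. -/
theorem volume_preimage_inter_column_le (n : ℕ) {A : Set ℝ} (hA : MeasurableSet A) :
    volume (D.transformation ⁻¹' A ∩ D.column n) ≤
      volume (A ∩ D.space) + ENNReal.ofReal (D.width n) := by
  have hsub : D.transformation ⁻¹' A ∩ D.column n ⊆
      (⋃ j ∈ Finset.range (D.height n - 1), D.transformation ⁻¹' A ∩ D.level n j) ∪
        D.level n (D.height n - 1) := by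
    rintro x ⟨hxA, hx⟩
    obtain ⟨j, hj, hxj⟩ := D.mem_column.1 hx
    by_cases h : j < D.height n - 1
    · left
      simp only [Set.mem_iUnion, Finset.mem_range, exists_prop]
      exact ⟨j, h, hxA, hxj⟩
    · right
      rwa [show D.height n - 1 = j by omega]
  refine (measure_mono hsub).trans ((measure_union_le _ _).trans ?_)
  rw [volume_level]
  refine add_le_add ?_ le_rfl
  refine (measure_biUnion_finset_le _ _).trans ?_
  calc ∑ j ∈ Finset.range (D.height n - 1), volume (D.transformation ⁻¹' A ∩ D.level n j)
      ≤ ∑ j ∈ Finset.range (D.height n - 1), volume (A ∩ D.level n (j + 1)) := by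
        refine Finset.sum_le_sum fun j hj => ?_
        have hj' : j + 1 < D.height n := by rw [Finset.mem_range] at hj; omega
        rw [← measure_preimage_add_right volume (D.left n (j + 1) - D.left n j)
          (A ∩ D.level n (j + 1))]
        refine measure_mono ?_
        rintro x ⟨hxA, hx⟩
        have h1 := D.transformation_mem_level hj' hx
        rw [Set.mem_preimage] at hxA
        rw [D.transformation_of_mem_level hj' hx] at h1 hxA
        exact ⟨hxA, h1⟩
    _ = volume (⋃ j ∈ Finset.range (D.height n - 1), A ∩ D.level n (j + 1)) := by
        rw [measure_biUnion_finset]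
        · intro j hj k hk hne
          simp only [Finset.coe_range, Set.mem_Iio] at hj hk
          refine Set.disjoint_left.2 fun x hx hx' => hne ?_
          have := D.eq_of_mem_level (by omega) (by omega) hx.2 hx'.2
          omega
        · exact fun j _ => hA.inter (D.measurableSet_level _ _)
    _ ≤ volume (A ∩ D.space) := by
        refine measure_mono (Set.iUnion₂_subset fun j hj => ?_)
        rw [Finset.mem_range] at hj
        exact Set.inter_subset_inter_right A
          ((D.level_subset_column (by omega)).trans (D.column_subset_space n))

theorem volume_preimage_inter_space_le {A : Set ℝ} (hA : MeasurableSet A) :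
    volume (D.transformation ⁻¹' A ∩ D.space) ≤ volume (A ∩ D.space) := by
  have h1 : Tendsto (fun n => volume (D.transformation ⁻¹' A ∩ D.column n)) atTop
      (𝓝 (volume (D.transformation ⁻¹' A ∩ D.space))) := by
    rw [space_eq, Set.inter_iUnion]
    exact tendsto_measure_iUnion_atTop fun m n h =>
      Set.inter_subset_inter_right _ (D.monotone_column h)
  have h2 : Tendsto (fun n => volume (A ∩ D.space) + ENNReal.ofReal (D.width n)) atTop
      (𝓝 (volume (A ∩ D.space))) := by
    have := ENNReal.tendsto_ofReal D.tendsto_width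
    rw [ENNReal.ofReal_zero] at this
    simpa using this.const_add (volume (A ∩ D.space))
  exact le_of_tendsto_of_tendsto' h1 h2 fun n => D.volume_preimage_inter_column_le n hA

theorem isProbabilityMeasure (hfin : volume D.space < ⊤) : IsProbabilityMeasure D.measure := by
  refine ⟨?_⟩
  rw [measure, Measure.smul_apply, Measure.restrict_apply_univ, smul_eq_mul,
    ENNReal.inv_mul_cancel D.volume_space_pos.ne' hfin.ne]

theorem measure_apply {A : Set ℝ} (hA : MeasurableSet A) :
    D.measure A = (volume D.space)⁻¹ * volume (A ∩ D.space) := by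
  rw [measure, Measure.smul_apply, Measure.restrict_apply hA, smul_eq_mul]

theorem measurePreserving_transformation (hfin : volume D.space < ⊤) :
    MeasurePreserving D.transformation D.measure D.measure := by
  have := D.isProbabilityMeasure hfin
  have hm := D.measurable_transformation
  refine ⟨hm, ?_⟩
  have := Measure.isProbabilityMeasure_map (μ := D.measure) hm.aemeasurable
  -- One inequality is enough: a probability measure dominated by another equals it.
  refine Measure.eq_of_le_of_isProbabilityMeasure (Measure.le_iff.2 fun A hA => ?_)
  rw [Measure.map_apply hm hA, D.measure_apply (hm hA), D.measure_apply hA]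
  exact mul_le_mul' le_rfl (D.volume_preimage_inter_space_le hA)

theorem measureReal_level {n j : ℕ} (hj : j < D.height n) :
    D.measure.real (D.level n j) = D.width n / volume.real D.space := by
  rw [measureReal_def, D.measure_apply (D.measurableSet_level n j),
    Set.inter_eq_left.2 ((D.level_subset_column hj).trans (D.column_subset_space n)),
    volume_level, ENNReal.toReal_mul, ENNReal.toReal_inv,
    ENNReal.toReal_ofReal (D.width_pos n).le, measureReal_def, div_eq_inv_mul]

theorem isColumnSystem (hfin : volume D.space < ⊤) :
    IsColumnSystem D.transformation D.measure D.height D.level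
      (fun n => D.width n / volume.real D.space) D.width where
  measurePreserving := D.measurePreserving_transformation hfin
  measurableSet := D.measurableSet_level
  eq_of_mem n j k x := D.eq_of_mem_level
  dist_le n j x hx y hy := by
    rw [level, Set.mem_Ico] at hx hy
    rw [Real.dist_eq, abs_le]
    constructor <;> linarith
  measure_eq n j hj := D.measureReal_level hj
  tendsto_width := D.tendsto_width
  tendsto_measure := by simpa using D.tendsto_width.div_const (volume.real D.space)
  tendsto_mul := by
    have hpos : 0 < volume.real D.space := ENNReal.toReal_pos D.volume_space_pos.ne' hfin.ne
    have h := ((ENNReal.tendsto_toReal hfin.ne).comp D.tendsto_volume_column).div_const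
      (volume.real D.space)
    rw [← measureReal_def, div_self hpos.ne'] at h
    refine h.congr fun n => ?_
    have := D.width_pos n
    simp only [Function.comp]
    rw [volume_column, ENNReal.toReal_ofReal (by positivity), mul_div_assoc]
  step n j x := D.transformation_mem_level

theorem measureReal_biUnion_level (hfin : volume D.space < ⊤) {n j : ℕ} (hj : j < D.height n) {K : Finset ℕ}
    (hK : K ⊆ Finset.range (D.r n)) :
    D.measure.real (⋃ i ∈ K, D.level (n + 1) (D.start n i + j)) =
      K.card * (D.width (n + 1) / volume.real D.space) := by
  have := D.isProbabilityMeasure hfin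
  have hlt : ∀ i ∈ K, D.start n i + j < D.height (n + 1) := fun i hi =>
    D.start_add_lt (Finset.mem_range.1 (hK hi)).le hj
  have hinj : ∀ i i', i < i' → D.start n i + j ≠ D.start n i' + j := by
    intro i i' h
    have := D.start_mono n (Nat.succ_le_of_lt h)
    rw [Nat.succ_eq_add_one, start_succ] at this
    omega
  rw [measureReal_biUnion_finset]
  · rw [Finset.sum_congr rfl fun i hi => D.measureReal_level (hlt i hi), Finset.sum_const,
      nsmul_eq_mul]
  · intro i hi i' hi' hne
    refine Set.disjoint_left.2 fun x hx hx' => ?_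
    have := D.eq_of_mem_level (hlt i hi) (hlt i' hi') hx hx'
    rcases lt_or_gt_of_ne hne with h | h
    · exact hinj i i' h this
    · exact hinj i' i h this.symm
  · exact fun i _ => D.measurableSet_level _ _

/-- A rank-one transformation with spacers of height at most one is weakly mixing, if at each
stage definite proportions of the subcolumns have no spacer, respectively one spacer. -/
theorem weaklyMixing (hs : ∀ n i, D.s n i ≤ 1) {c : ℝ} (hc : 0 < c)
    (h : ∀ n, ∀ a ≤ 1, c * (D.r n + 1) ≤ ((Finset.range (D.r n)).filter (D.s n · = a)).card) :
    WeaklyMixing D.transformation D.measure := by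
  have hfin := D.volume_space_lt_top hs
  have hprob := D.isProbabilityMeasure hfin
  refine ⟨hprob, D.measurePreserving_transformation hfin,
    (D.isColumnSystem hfin).ergodic_prodMap hc fun n => ?_⟩
  have hpos : 0 < volume.real D.space := ENNReal.toReal_pos D.volume_space_pos.ne' hfin.ne
  have key : ∀ a ≤ 1, ∀ j < D.height n,
      (⋃ i ∈ (Finset.range (D.r n)).filter (D.s n · = a),
        D.level (n + 1) (D.start n i + j)) ⊆ D.level n j ∧
      MeasurableSet (⋃ i ∈ (Finset.range (D.r n)).filter (D.s n · = a),
        D.level (n + 1) (D.start n i + j)) ∧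
      c * (D.width n / volume.real D.space) ≤
        D.measure.real (⋃ i ∈ (Finset.range (D.r n)).filter (D.s n · = a),
          D.level (n + 1) (D.start n i + j)) := by
    intro a ha j hj
    refine ⟨Set.iUnion₂_subset fun i hi => ?_,
      Finset.measurableSet_biUnion _ fun _ _ => D.measurableSet_level _ _, ?_⟩
    · exact D.level_start_subset
        (Finset.mem_range.1 (Finset.mem_filter.1 hi).1).le hj
    · rw [D.measureReal_biUnion_level hfin hj (Finset.filter_subset _ _), D.width_eq n,
        mul_div_assoc, ← mul_assoc]
      have := D.width_pos (n + 1)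
      exact mul_le_mul_of_nonneg_right (h n a ha) (by positivity)
  -- The same return time serves both families: subcolumns without spacer move up one level, those
  -- with one spacer return to the same level.
  refine ⟨D.height n + 1,
    fun j => ⋃ i ∈ (Finset.range (D.r n)).filter (D.s n · = 0),
      D.level (n + 1) (D.start n i + j),
    fun j => ⋃ i ∈ (Finset.range (D.r n)).filter (D.s n · = 1),
      D.level (n + 1) (D.start n i + j), fun j hj => ?_, fun j hj => ?_⟩
  · obtain ⟨h1, h2, h3⟩ := key 0 zero_le_one j (by omega)
    refine ⟨h1, h2, h3, fun x hx => ?_⟩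
    simp only [Set.mem_iUnion, exists_prop, Finset.mem_filter, Finset.mem_range] at hx
    obtain ⟨i, ⟨hi, hsi⟩, hx⟩ := hx
    exact D.iterate_mem_of_spacer_eq_zero hi hsi hj hx
  · obtain ⟨h1, h2, h3⟩ := key 1 le_rfl j (by omega)
    refine ⟨h1, h2, h3, fun x hx => ?_⟩
    simp only [Set.mem_iUnion, exists_prop, Finset.mem_filter, Finset.mem_range] at hx
    obtain ⟨i, ⟨hi, hsi⟩, hx⟩ := hx
    exact D.iterate_mem_of_spacer_eq_one hi hsi (by omega) hx

end RankOneData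

/-! ## The construction -/

theorem flatMap_range_const (w : List (Fin 2)) (k : ℕ) :
    ((List.range k).flatMap fun _ => w) = wordPow w k := by
  induction k with
  | zero => simp [wordPow_zero]
  | succ k ih => rw [List.range_succ, List.flatMap_append, ih, wordPow_succ']; simp

theorem flatMap_range_spacer (b : List (Fin 2)) (γ l : ℕ) :
    ((List.range (l * (γ + 1))).flatMap fun i =>
      b ++ List.replicate (if i % (γ + 1) < γ then 1 else 0) 1) = wordPow (spacedPow γ b) l := by
  induction l with
  | zero => simp [wordPow_zero]
  | succ l ih =>
    rw [Nat.succ_mul, List.range_add, List.flatMap_append, ih, wordPow_succ', List.flatMap_map]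
    congr 1
    simp only [Nat.mul_add_mod_self_right]
    rw [List.range_succ, List.flatMap_append, List.flatMap_singleton, spacedPow,
      ← flatMap_range_const]
    congr 1
    · refine List.flatMap_congr fun i hi => ?_
      rw [List.mem_range] at hi
      rw [Nat.mod_eq_of_lt (by omega), if_pos hi]
      rfl
    · rw [Nat.mod_eq_of_lt (Nat.lt_succ_self γ), if_neg (lt_irrefl γ)]
      simp

/-- The rank-one construction in which `B_{n+1}` is `((B_n 1)^γ B_n)^(L n)`. -/
def spacedData (γ : ℕ) (L : ℕ → ℕ) (hγ : 1 < γ) (hL : ∀ n, 1 < L n) : RankOneData where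
  r n := L n * (γ + 1) - 1
  s _ i := if i % (γ + 1) < γ then 1 else 0
  one_le_r n := by
    have := Nat.mul_le_mul (hL n).le hγ.le
    have := hL n
    rw [Nat.mul_succ]
    omega

section spacedData

variable {γ : ℕ} {L : ℕ → ℕ} (hγ : 1 < γ) (hL : ∀ n, 1 < L n)

theorem spacedData_r_succ (n : ℕ) : (spacedData γ L hγ hL).r n + 1 = L n * (γ + 1) :=
  Nat.sub_add_cancel (Nat.mul_pos (by have := hL n; omega) (Nat.succ_pos γ))

theorem word_spacedData_succ (n : ℕ) : (spacedData γ L hγ hL).word (n + 1) =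
    wordPow (spacedPow γ ((spacedData γ L hγ hL).word n)) (L n) := by
  rw [RankOneData.word, spacedData_r_succ]
  exact flatMap_range_spacer _ _ _

theorem weaklyMixing_spacedData :
    WeaklyMixing (spacedData γ L hγ hL).transformation (spacedData γ L hγ hL).measure := by
  refine RankOneData.weaklyMixing _ (c := 1 / (2 * (γ + 1))) (fun n i => ?_) (by positivity)
    fun n a ha => ?_
  · change (if i % (γ + 1) < γ then 1 else 0) ≤ 1
    split_ifs <;> omega
  · have hr := spacedData_r_succ hγ hL n
    have hLn := hL n
    -- There are `L n * (γ + 1)` subcolumns, and at least half of `L n` of them are of each kind;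
    -- hence `c = 1 / (2(γ + 1))`.
    have hcard : L n ≤ 2 * ((Finset.range ((spacedData γ L hγ hL).r n)).filter
        ((spacedData γ L hγ hL).s n · = a)).card := by
      have hinj : ∀ e, Function.Injective fun t : ℕ => t * (γ + 1) + e := fun e t t' h =>
        Nat.eq_of_mul_eq_mul_right (Nat.succ_pos γ) (Nat.add_right_cancel h)
      obtain rfl | rfl : a = 0 ∨ a = 1 := by omega
      -- The last subcolumn also has no spacer, but has no successor in the column; `L n - 1 ≥ L n /
      -- 2` remain.
      · have hsub : (Finset.range (L n - 1)).image (fun t => t * (γ + 1) + γ) ⊆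
            (Finset.range ((spacedData γ L hγ hL).r n)).filter
              ((spacedData γ L hγ hL).s n · = 0) := by
          intro i hi
          simp only [Finset.mem_image, Finset.mem_range, Finset.mem_filter] at hi ⊢
          obtain ⟨t, ht, rfl⟩ := hi
          refine ⟨?_, ?_⟩
          · have := Nat.mul_le_mul_right (γ + 1) (show t + 2 ≤ L n by omega)
            rw [← hr] at this
            nlinarith
          · change (if (t * (γ + 1) + γ) % (γ + 1) < γ then 1 else 0) = 0
            rw [Nat.mul_add_mod_self_right, Nat.mod_eq_of_lt (Nat.lt_succ_self γ),
              if_neg (lt_irrefl γ)]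
        have := Finset.card_le_card hsub
        rw [Finset.card_image_of_injective _ (hinj γ), Finset.card_range] at this
        omega
      -- The residue class 0 already supplies enough subcolumns with a spacer.
      · have hsub : (Finset.range (L n)).image (fun t => t * (γ + 1) + 0) ⊆
            (Finset.range ((spacedData γ L hγ hL).r n)).filter
              ((spacedData γ L hγ hL).s n · = 1) := by
          intro i hi
          simp only [Finset.mem_image, Finset.mem_range, Finset.mem_filter] at hi ⊢
          obtain ⟨t, ht, rfl⟩ := hi
          refine ⟨?_, ?_⟩
          · have := Nat.mul_le_mul_right (γ + 1) (show t + 1 ≤ L n by omega)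
            rw [← hr] at this
            nlinarith
          · change (if (t * (γ + 1) + 0) % (γ + 1) < γ then 1 else 0) = 1
            rw [Nat.mul_add_mod_self_right, Nat.zero_mod, if_pos (by omega)]
        have := Finset.card_le_card hsub
        rw [Finset.card_image_of_injective _ (hinj 0), Finset.card_range] at this
        omega
    have hrR : ((spacedData γ L hγ hL).r n : ℝ) + 1 = L n * (γ + 1) := by exact_mod_cast hr
    have hcR : (L n : ℝ) ≤ 2 * ((Finset.range ((spacedData γ L hγ hL).r n)).filter
        ((spacedData γ L hγ hL).s n · = a)).card := by exact_mod_cast hcard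
    rw [hrR]
    have : 1 / (2 * ((γ : ℝ) + 1)) * (L n * (γ + 1)) = L n / 2 := by field_simp
    rw [this]
    linarith

end spacedData

/-- The lengths of the words obtained when the exponents are chosen by the rule `F`, as functions
of the stage and of the current length. -/
def chosenLength (γ : ℕ) (F : ℕ → ℕ → ℕ) : ℕ → ℕ
  | 0 => 1
  | n + 1 => F n (chosenLength γ F n) * ((γ + 1) * chosenLength γ F n + γ)

theorem theorem5p9 (ε : ℝ) (hε : 0 < ε) (f : ℕ → ℝ)
    (hf : Filter.Tendsto f Filter.atTop Filter.atTop) :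
    ∃ (D : RankOneData) (γ : ℕ) (L : ℕ → ℕ),
      1 < γ ∧ (∀ n, 1 < L n) ∧ Filter.Tendsto L Filter.atTop Filter.atTop ∧
      (∀ n, D.word (n + 1) = wordPow (wordPow (D.word n ++ [1]) γ ++ D.word n) (L n)) ∧
      WeaklyMixing D.transformation D.measure ∧
      Filter.limsup (fun q : ℕ => (((complexity D.subshift q : ℝ) / (q : ℝ) : ℝ) : EReal))
        Filter.atTop < ((3 / 2 + ε : ℝ) : EReal) ∧
      ∃ᶠ q : ℕ in Filter.atTop, (complexity D.subshift q : ℝ) < (q : ℝ) + f q := by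
  obtain ⟨K, hK⟩ := exists_nat_ge (4 / ε)
  have hbig : ∀ m : ℕ, K ≤ m → 1 ≤ ε / 4 * m := by
    intro m hm
    have h1 : 4 / ε ≤ m := hK.trans (by exact_mod_cast hm)
    rw [div_le_iff₀ hε] at h1
    linarith
  set γ := K + 2 with hγdef
  have hγ : 1 < γ := by omega
  -- The conditions on an exponent at stage `n` and length `h`: `n ≤ l` for divergence, `K ≤ l` for
  -- the limsup, the last one for the low-complexity lengths. They involve the current length, hence
  -- the earlier exponents; `chosenLength` resolves this recursion.
  have hF : ∀ n h : ℕ, ∃ l : ℕ, 1 < l ∧ n ≤ l ∧ K ≤ l ∧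
      ∀ q ≥ l, (((γ + 1) * h + γ : ℕ) : ℝ) < f q := by
    intro n h
    obtain ⟨N, hN⟩ := Filter.eventually_atTop.1
      (hf.eventually_gt_atTop (((γ + 1) * h + γ : ℕ) : ℝ))
    exact ⟨N + n + K + 2, by omega, by omega, by omega, fun q hq => hN q (by omega)⟩
  choose F hF1 hFn hFK hFf using hF
  set L : ℕ → ℕ := fun n => F n (chosenLength γ F n)
  have hL : ∀ n, 1 < L n := fun n => hF1 _ _
  set D := spacedData γ L hγ hL
  have hword : ∀ n, D.word (n + 1) = wordPow (spacedPow γ (D.word n)) (L n) :=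
    word_spacedData_succ hγ hL
  have hlen : ∀ n, (D.word n).length = chosenLength γ F n := by
    intro n
    induction n with
    | zero => rfl
    | succ n ih => rw [length_succ hword, length_spacedPow, ih]; rfl
  have hpos : 0 < (D.word 0).length := Nat.one_pos
  refine ⟨D, γ, L, hγ, hL, Filter.tendsto_atTop_mono (fun n => hFn n _) Filter.tendsto_id, hword,
    weaklyMixing_spacedData hγ hL, ?_, ?_⟩
  · refine lt_of_le_of_lt (b := ((3 / 2 + ε / 2 : ℝ) : EReal)) ?_
      (EReal.coe_lt_coe_iff.2 (by linarith))
    refine Filter.limsup_le_of_le (h := ?_)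
    filter_upwards [Filter.eventually_ge_atTop (K + 2)] with q hq
    rw [EReal.coe_le_coe_iff]
    have hq0 : (0 : ℝ) < q := by
      have : 0 < q := by omega
      exact_mod_cast this
    obtain ⟨n, hn⟩ : ∃ n, q ≤ 2 * (D.word (n + 1)).length :=
      ⟨q, by have := lt_length hpos hL hword (q + 1); omega⟩
    have hfin := (ncard_factorsOfLength_le_of_le_word hγ hL hword n (by omega) hn).1
    have h1 : (complexity D.subshift q : ℝ) ≤ (factorsOfLength D.word q).ncard := by
      exact_mod_cast D.complexity_le hfin
    -- Another `ε/4` is kept to absorb the additive 1, as `1 ≤ (ε/4) q` for `q ≥ K`.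
    have h2 := ncard_factorsOfLength_le rfl hγ hL hword (δ := ε / 4) (hbig γ (by omega))
      (fun n => hbig _ (hFK n _)) (q := q) (by omega)
    rw [div_le_iff₀ hq0]
    have := hbig q (by omega)
    linarith
  · rw [Filter.frequently_atTop]
    intro N
    have hlt := lt_length hpos hL hword (N + 1)
    refine ⟨(D.word (N + 1)).length, by omega, ?_⟩
    obtain ⟨hfin, hle⟩ := ncard_factorsOfLength_le_of_le_word hγ hL hword N
      (q := (D.word (N + 1)).length) (by omega) (by omega)
    have h1 := (D.complexity_le hfin).trans hle
    rw [Nat.sub_self, Nat.add_zero] at h1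
    have h2 : (complexity D.subshift (D.word (N + 1)).length : ℝ) ≤
        (spacedPow γ (D.word N)).length + (D.word (N + 1)).length := by exact_mod_cast h1
    -- The length `|B_{N+1}|` is a positive multiple of `L N`, so it lies in the range where `f`
    -- exceeds `|u_N|`.
    have h3 := hFf N (chosenLength γ F N) (D.word (N + 1)).length (by
      rw [length_succ hword]
      refine Nat.le_mul_of_pos_right _ ?_
      rw [length_spacedPow]
      omega)
    rw [← hlen N, ← length_spacedPow] at h3
    linarith
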